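/- Let $n\ge 1$, $s\in(0,1)$, and let $\Omega\subset\mathbb R^n$ be a bounded open set with Lipschitz boundary; write $\mathcal C\Omega:=\mathbb R^n\setminus\Omega$ and $Q(\Omega):=\mathbb R^{2n}\setminus(\mathcal C\Omega)^2$. For $q\in[1,\infty)$ and measurable $u:\mathbb R^n\to\mathbb R$ put $$\mathcal E_s^q(u):=\frac1{2q}\iint_{Q(\Omega)}\frac{|u(x)-u(y)|^q}{|x-y|^{n+sq}}\,dx\,dy .$$ Let $\mathcal W^{s,q}(\Omega)$ be the set of measurable $u:\mathbb R^n\to\mathbb R$ with $u|_\Omega\in W^{s,q}(\Omega)$, that is, $u\in L^q(\Omega)$ and $\int_\Omega\int_\Omega\frac{|u(x)-u(y)|^q}{|x-y|^{n+sq}}\,dx\,dy<\infty$. For $\varphi:\mathcal C\Omega\to\mathbb R$ let $\mathcal W^{s,q}_\varphi(\Omega)$ be the set of $u\in\mathcal W^{s,q}(\Omega)$ with $u=\varphi$ a.e. in $\mathcal C\Omega$, and put $$\mathrm{Tail}_s^q(\varphi,\mathcal C\Omega;x):=\int_{\mathcal C\Omega}\frac{|\varphi(y)|^q}{|x-y|^{n+sq}}\,dy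 .$$ A function $u\in\mathcal W^{s,q}(\Omega)$ is called an $(s,q)$-minimizer in $\Omega$ if $\mathcal E_s^q(u)<\infty$ and $\mathcal E_s^q(u)\le\mathcal E_s^q(v)$ for all $v\in\mathcal W^{s,q}(\Omega)$ with $v=u$ a.e. in $\mathcal C\Omega$. **Theorem.** Let $p_k>1$ with $p_k\to1$ as $k\to\infty$, and let $\varphi_k,\varphi:\mathcal C\Omega\to\mathbb R$ be such that $$\sup_{k\in\mathbb N}\mathrm{Tail}_s^{p_k}(\varphi_k,\mathcal C\Omega;\cdot)\in L^1(\Omega)\qquad\text{and}\qquad \varphi_k\to\varphi\ \text{ a.e. in }\mathcal C\Omega .$$ For every $k$ let $u_{p_k}\in\mathcal W^{s,p_k}_{\varphi_k}(\Omega)$ be an $(s,p_k)$-minimizer in $\Omega$. Then there exist a subsequence $(p_{k_j})_j$ and a function $u_1\in\mathcal W^{s,1}_\varphi(\Omega)$ such that $$u_{p_{k_j}}\to u_1\quad\text{in }L^1(\Omega)\text{ and a.e. in }\mathbb R^n .$$ Furthermore, $\mathrm{Tail}_s^1(\varphi,\mathcal C\Omega;\cdot)\in L^1(\Omega)$ and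 $u_1$ is an $(s,1)$-minimizer in $\Omega$. -/

import Mathlib

open MeasureTheory Set Filter Topology
open scoped ENNReal

namespace FracMin

/-- The Euclidean space `ℝⁿ`. -/
abbrev Rn (n : ℕ) : Type := EuclideanSpace ℝ (Fin n)

/-- The open set `Ω` has Lipschitz boundary: near every boundary point `x₀` there are a unit
direction `e` and a Lipschitz function `g` of the component of `x` orthogonal to `e` such that,
in a ball around `x₀`, the set `Ω` is the strict epigraph of `g` in the direction `e`. (Only the
values of `g` on the hyperplane orthogonal to `e` matter; a Lipschitz function on that hyperplane
is the same as the restriction of a Lipschitz function on the whole space.) -/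
def HasLipschitzBoundary {n : ℕ} (Ω : Set (Rn n)) : Prop :=
  ∀ x₀ ∈ frontier Ω, ∃ (e : Rn n) (g : Rn n → ℝ) (L : NNReal) (r : ℝ),
    ‖e‖ = 1 ∧ LipschitzWith L g ∧ 0 < r ∧
      ∀ x ∈ Metric.ball x₀ r, (x ∈ Ω ↔ g (x - inner ℝ e x • e) < inner ℝ e x)

/-- The integrand `|u(x) - u(y)|^q / |x - y|^(n + s q)`. -/
noncomputable def gagliardoIntegrand {n : ℕ} (s q : ℝ) (u : Rn n → ℝ) (x y : Rn n) : ℝ≥0∞ :=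
  ENNReal.ofReal (|u x - u y| ^ q / ‖x - y‖ ^ ((n : ℝ) + s * q))

/-- `Q(Ω) = ℝ²ⁿ \ (ℝⁿ \ Ω)²`. -/
def Q {n : ℕ} (Ω : Set (Rn n)) : Set (Rn n × Rn n) := (Ωᶜ ×ˢ Ωᶜ)ᶜ

/-- The nonlocal `(s,q)`-energy, with values in `[0, ∞]`. -/
noncomputable def energy {n : ℕ} (Ω : Set (Rn n)) (s q : ℝ) (u : Rn n → ℝ) : ℝ≥0∞ :=
  ENNReal.ofReal (1 / (2 * q)) * ∫⁻ z in Q Ω, gagliardoIntegrand s q u z.1 z.2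

/-- The Gagliardo seminorm of order `(s,q)` on `Ω`, with values in `[0, ∞]`. -/
noncomputable def gagliardoSeminorm {n : ℕ} (Ω : Set (Rn n)) (s q : ℝ) (u : Rn n → ℝ) : ℝ≥0∞ :=
  (∫⁻ x in Ω, ∫⁻ y in Ω, gagliardoIntegrand s q u x y) ^ (1 / q)

/-- `u` restricted to `Ω` belongs to the fractional Sobolev space `W^{s,q}(Ω)`. -/
def MemFracSobolev {n : ℕ} (Ω : Set (Rn n)) (s q : ℝ) (u : Rn n → ℝ) : Prop :=
  MemLp u (ENNReal.ofReal q) (volume.restrict Ω) ∧ gagliardoSeminorm Ω s q u < ⊤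

/-- The space `𝒲^{s,q}(Ω)` of (Lebesgue) measurable functions on the whole of `ℝⁿ` whose
restriction to `Ω` belongs to `W^{s,q}(Ω)`. -/
def spaceW {n : ℕ} (Ω : Set (Rn n)) (s q : ℝ) : Set (Rn n → ℝ) :=
  {u | AEMeasurable u volume ∧ MemFracSobolev Ω s q u}

/-- The space `𝒲^{s,q}_φ(Ω)` of the `u` in `𝒲^{s,q}(Ω)` with `u = φ` a.e. in the complement of
`Ω`. Only the values of `φ` on the complement of `Ω` matter. -/
def spaceWData {n : ℕ} (Ω : Set (Rn n)) (s q : ℝ) (φ : Rn n → ℝ) : Set (Rn n → ℝ) :=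
  {u | u ∈ spaceW Ω s q ∧ ∀ᵐ x ∂(volume.restrict Ωᶜ), u x = φ x}

/-- `u` is an `(s,q)`-minimizer in `Ω`. -/
def IsMinimizer {n : ℕ} (Ω : Set (Rn n)) (s q : ℝ) (u : Rn n → ℝ) : Prop :=
  u ∈ spaceW Ω s q ∧ energy Ω s q u < ⊤ ∧
    ∀ v ∈ spaceW Ω s q, (∀ᵐ x ∂(volume.restrict Ωᶜ), v x = u x) →
      energy Ω s q u ≤ energy Ω s q v

/-- The nonlocal tail `Tail_s^q(φ, ℝⁿ \ Ω; x)`, with values in `[0, ∞]`. -/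
noncomputable def tail {n : ℕ} (Ω : Set (Rn n)) (s q : ℝ) (φ : Rn n → ℝ) (x : Rn n) : ℝ≥0∞ :=
  ∫⁻ y in Ωᶜ, ENNReal.ofReal (|φ y| ^ q / ‖x - y‖ ^ ((n : ℝ) + s * q))

/-- A `[0, ∞]`-valued function belongs to `L¹(Ω)`. -/
def MemL1 {n : ℕ} (Ω : Set (Rn n)) (f : Rn n → ℝ≥0∞) : Prop :=
  AEMeasurable f (volume.restrict Ω) ∧ ∫⁻ x in Ω, f x < ⊤

end FracMin

namespace FracMin

/-! Compactness. Comparing `u k` with the function equal to it outside `Ω` and to 0 inside bounds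
the double integral over `Q Ω` by twice the integral of the tail, uniformly in `k`. Subtracting that
competitor, the cut functions `Ω.indicator (u k)` have bounded seminorms over `Ω ×ˢ univ`. The
inequality `a ≤ l + l ^ (1 - q) * a ^ q` with `l = |x - y| ^ s` turns this into an `L¹` bound on
differences whose constants do not depend on the exponent. Hence averages over small balls
approximate the cut functions uniformly in `L¹` by step functions, and a subsequence converges
(`exists_subseq_tendsto_L1`). Outside `Ω` convergence is part of the data, and Fatou gives the
finiteness of the limit energy and tail.

Minimality. For a fixed `ψ` vanishing outside `Ω`, the function `u k + ψ` already has the exterior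
data of `u k`, so no recovery sequence is needed. The nonnegative convexity defect `2^(q-1) (|ψ|^q +
|u|^q) - |u + ψ|^q`, written for differences, has an integral that minimality bounds by essentially
the energy of `ψ`; Fatou applied to the defect gives minimality of the limit against `ψ`
(`lintegral_Q_le_add_of_tendsto`). This needs the `p k`-energies of `ψ` to be finite and to
converge, which holds for bounded Lipschitz `ψ`.

Density. A competitor `v` of finite 1-energy gives `ψ = v - u₁` of finite seminorm on the whole
space, to be approximated by Lipschitz functions vanishing outside `Ω` (`exists_lipschitz_approx`):
cut off near the boundary, then mollify. The cutoff error is dominated using the integral of `|ψ|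
d^(-s)`, with `d` the distance to the complement. It is finite because the seminorm contains the
interaction of `Ω` with its complement, and near each point of a Lipschitz boundary the complement
contains balls of comparable scale. -/

/-! ### Elementary properties of the Gagliardo integrand -/

theorem aemeasurable_gagliardoIntegrand {n : ℕ} (s q : ℝ) {u : Rn n → ℝ} {μ : Measure (Rn n)}
    [SFinite μ] (hu : AEMeasurable u μ) :
    AEMeasurable (fun z : Rn n × Rn n => gagliardoIntegrand s q u z.1 z.2) (μ.prod μ) := by
  have h1 : AEMeasurable (fun z : Rn n × Rn n => u z.1) (μ.prod μ) := hu.comp_fst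
  have h2 : AEMeasurable (fun z : Rn n × Rn n => u z.2) (μ.prod μ) := hu.comp_snd
  unfold gagliardoIntegrand
  have h3 : AEMeasurable (fun z : Rn n × Rn n => ‖z.1 - z.2‖ ^ ((n : ℝ) + s * q)) (μ.prod μ) := by
    apply Measurable.aemeasurable
    fun_prop
  have h4 : AEMeasurable (fun z : Rn n × Rn n => |u z.1 - u z.2| ^ q) (μ.prod μ) := by
    have := h1.sub h2
    exact (this.norm.pow_const q)
  exact (h4.div h3).ennreal_ofReal

theorem gagliardoIntegrand_comm {n : ℕ} (s q : ℝ) (u : Rn n → ℝ) (x y : Rn n) :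
    gagliardoIntegrand s q u x y = gagliardoIntegrand s q u y x := by
  simp only [gagliardoIntegrand, abs_sub_comm (u x), norm_sub_rev x]

theorem abs_add_rpow_le (a b : ℝ) {q : ℝ} (hq : 1 ≤ q) :
    |a + b| ^ q ≤ 2 ^ (q - 1) * (|a| ^ q + |b| ^ q) := by
  have h := NNReal.rpow_add_le_mul_rpow_add_rpow ‖a‖₊ ‖b‖₊ hq
  have h' : (‖a‖ + ‖b‖) ^ q ≤ 2 ^ (q - 1) * (‖a‖ ^ q + ‖b‖ ^ q) := by exact_mod_cast h
  calc |a + b| ^ q ≤ (|a| + |b|) ^ q :=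
        Real.rpow_le_rpow (abs_nonneg _) (abs_add_le a b) (by linarith)
    _ ≤ _ := h'

theorem gagliardoIntegrand_add_le {n : ℕ} (s : ℝ) {q : ℝ} (hq : 1 ≤ q) (u v : Rn n → ℝ)
    (x y : Rn n) :
    gagliardoIntegrand s q (u + v) x y ≤ ENNReal.ofReal (2 ^ (q - 1)) *
      (gagliardoIntegrand s q u x y + gagliardoIntegrand s q v x y) := by
  unfold gagliardoIntegrand
  rw [← ENNReal.ofReal_add (by positivity) (by positivity), ← ENNReal.ofReal_mul (by positivity)]
  apply ENNReal.ofReal_le_ofReal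
  rw [← add_div, ← mul_div_assoc]
  gcongr
  have := abs_add_rpow_le (u x - u y) (v x - v y) hq
  rwa [show u x - u y + (v x - v y) = (u + v) x - (u + v) y by simp; ring] at this

theorem aemeasurable_gagliardoIntegrand_volume {n : ℕ} (s q : ℝ) {u : Rn n → ℝ}
    (hu : AEMeasurable u) :
    AEMeasurable (fun z : Rn n × Rn n => gagliardoIntegrand s q u z.1 z.2) :=
  aemeasurable_gagliardoIntegrand s q hu

theorem lintegral_gagliardoIntegrand_add_le {n : ℕ} (s : ℝ) {u : Rn n → ℝ}
    {ν : Measure (Rn n × Rn n)}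
    (hu : AEMeasurable (fun z : Rn n × Rn n => gagliardoIntegrand s 1 u z.1 z.2) ν)
    (v : Rn n → ℝ) :
    ∫⁻ z, gagliardoIntegrand s 1 (u + v) z.1 z.2 ∂ν ≤
      (∫⁻ z, gagliardoIntegrand s 1 u z.1 z.2 ∂ν) + ∫⁻ z, gagliardoIntegrand s 1 v z.1 z.2 ∂ν := by
  rw [← lintegral_add_left' hu]
  refine lintegral_mono fun z => ?_
  simpa using gagliardoIntegrand_add_le s le_rfl u v z.1 z.2

theorem gagliardoIntegrand_ne_top {n : ℕ} (s q : ℝ) (u : Rn n → ℝ) (x y : Rn n) :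
    gagliardoIntegrand s q u x y ≠ ⊤ := ENNReal.ofReal_ne_top

theorem gagliardoIntegrand_congr_ae {n : ℕ} (s q : ℝ) {u v : Rn n → ℝ} {μ : Measure (Rn n)}
    [SFinite μ] (h : u =ᵐ[μ] v) :
    (fun z : Rn n × Rn n => gagliardoIntegrand s q u z.1 z.2) =ᵐ[μ.prod μ]
      fun z => gagliardoIntegrand s q v z.1 z.2 := by
  filter_upwards [Measure.quasiMeasurePreserving_fst.ae h,
    Measure.quasiMeasurePreserving_snd.ae h] with z h1 h2
  simp only [gagliardoIntegrand, h1, h2]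

/-- Pointwise convergence of the integrands when both the exponent and the function vary. -/
theorem tendsto_gagliardoIntegrand {n : ℕ} (s : ℝ) {ι : Type*} {l : Filter ι} {q : ι → ℝ}
    {q₀ : ℝ} (hq₀ : 0 < q₀) (hq : Tendsto q l (𝓝 q₀)) (hqpos : ∀ i, 0 < q i)
    {u : ι → Rn n → ℝ} {v : Rn n → ℝ} {x y : Rn n}
    (hx : Tendsto (fun i => u i x) l (𝓝 (v x))) (hy : Tendsto (fun i => u i y) l (𝓝 (v y))) :
    Tendsto (fun i => gagliardoIntegrand s (q i) (u i) x y) l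
      (𝓝 (gagliardoIntegrand s q₀ v x y)) := by
  -- On the diagonal the numerator is `0 ^ r = 0` for positive `r`, so the singular denominator
  -- plays no role.
  by_cases hxy : x = y
  · subst hxy
    have h0 : ∀ (r : ℝ) (w : Rn n → ℝ), 0 < r → gagliardoIntegrand s r w x x = 0 := by
      intro r w hr
      simp [gagliardoIntegrand, Real.zero_rpow hr.ne']
    rw [h0 _ _ hq₀]
    simpa [h0 _ _ (hqpos _)] using tendsto_const_nhds
  · unfold gagliardoIntegrand
    have hpos : 0 < ‖x - y‖ := norm_pos_iff.2 (sub_ne_zero.2 hxy)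
    refine (ENNReal.continuous_ofReal.tendsto _).comp (Tendsto.div ?_ ?_ ?_)
    · exact ((hx.sub hy).abs).rpow hq (Or.inr hq₀)
    · exact (tendsto_const_nhds).rpow (tendsto_const_nhds.add (tendsto_const_nhds.mul hq))
        (Or.inl hpos.ne')
    · positivity

/-! ### The truncated kernel -/

/-- The kernel `min(1, c|h|) / |h|^(n+s)`. -/
noncomputable def truncKernel (n : ℕ) (s c : ℝ) (h : Rn n) : ℝ :=
  min 1 (c * ‖h‖) / ‖h‖ ^ ((n : ℝ) + s)

theorem measurable_truncKernel (n : ℕ) (s c : ℝ) : Measurable (truncKernel n s c) := by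
  unfold truncKernel; fun_prop

/-- In polar coordinates the weight `r ^ (n - 1)` leaves `r ^ (-s)` on `(0, 1]`, integrable since `s
< 1`, and `r ^ (-1 - s)` beyond 1, integrable since `s > 0`. -/
theorem integrable_truncKernel_one {n : ℕ} (hn : 1 ≤ n) {s : ℝ} (hs0 : 0 < s) (hs1 : s < 1) :
    Integrable (truncKernel n s 1) := by
  have : Nonempty (Fin n) := ⟨⟨0, hn⟩⟩
  have := (integrable_fun_norm_addHaar (volume : Measure (Rn n))
    (f := fun r : ℝ => min 1 (1 * r) / r ^ ((n : ℝ) + s))).2 ?_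
  · exact this
  rw [finrank_euclideanSpace_fin, ← Ioc_union_Ioi_eq_Ioi (zero_le_one' ℝ)]
  refine IntegrableOn.union ?_ ?_
  · have h1 : IntegrableOn (fun r : ℝ => r ^ (-s)) (Ioc 0 1) :=
      (intervalIntegrable_iff_integrableOn_Ioc_of_le zero_le_one).1
        (intervalIntegral.intervalIntegrable_rpow' (by linarith))
    refine h1.congr_fun (fun r hr => ?_) measurableSet_Ioc
    have hr0 : 0 < r := hr.1
    simp only [smul_eq_mul, one_mul, min_eq_right hr.2]
    rw [← Real.rpow_natCast, ← mul_div_assoc, ← Real.rpow_add_one hr0.ne', ← Real.rpow_sub hr0]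
    congr 1
    rw [Nat.cast_sub hn]; simp
  · have h1 : IntegrableOn (fun r : ℝ => r ^ (-1-s)) (Ioi 1) :=
      integrableOn_Ioi_rpow_of_lt (by linarith) one_pos
    refine h1.congr_fun (fun r hr => ?_) measurableSet_Ioi
    have hr1 : 1 < r := hr
    have hr0 : 0 < r := by linarith
    simp only [smul_eq_mul, one_mul, min_eq_left hr1.le]
    rw [← Real.rpow_natCast, mul_one_div, ← Real.rpow_sub hr0]
    congr 1
    rw [Nat.cast_sub hn]; simp; ring

theorem lintegral_truncKernel_one_lt_top {n : ℕ} (hn : 1 ≤ n) {s : ℝ} (hs0 : 0 < s)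
    (hs1 : s < 1) : ∫⁻ h, ENNReal.ofReal (truncKernel n s 1 h) < ⊤ :=
  (integrable_truncKernel_one hn hs0 hs1).lintegral_lt_top

/-- The kernel scales as `c ^ (n + s)` times the unit kernel at `c • h`, and the change of variables
returns `c ^ (-n)`. With `c` a multiple of `1 / d` this produces the Hardy weight `d ^ (-s)`. -/
theorem lintegral_truncKernel (n : ℕ) (s : ℝ) {c : ℝ} (hc : 0 < c) :
    ∫⁻ h, ENNReal.ofReal (truncKernel n s c h) =
      ENNReal.ofReal (c ^ s) * ∫⁻ h, ENNReal.ofReal (truncKernel n s 1 h) := by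
  have hm := (measurable_truncKernel n s 1).ennreal_ofReal
  have h1 : ∫⁻ h, ENNReal.ofReal (truncKernel n s 1 (c • h)) =
      ENNReal.ofReal (c ^ n)⁻¹ * ∫⁻ h, ENNReal.ofReal (truncKernel n s 1 h) := by
    rw [← lintegral_map hm (measurable_const_smul c), Measure.map_addHaar_smul _ hc.ne',
      lintegral_smul_measure, finrank_euclideanSpace_fin, abs_of_nonneg (by positivity),
      smul_eq_mul]
  have h2 : ∀ h : Rn n, ENNReal.ofReal (truncKernel n s c h) =
      ENNReal.ofReal (c ^ ((n : ℝ) + s)) * ENNReal.ofReal (truncKernel n s 1 (c • h)) := by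
    intro h
    rw [← ENNReal.ofReal_mul (by positivity)]
    congr 1
    simp only [truncKernel, norm_smul, Real.norm_of_nonneg hc.le, one_mul]
    rw [Real.mul_rpow hc.le (norm_nonneg _), ← mul_div_assoc,
      mul_div_mul_left _ _ (by positivity)]
  simp_rw [h2]
  rw [lintegral_const_mul' _ _ ENNReal.ofReal_ne_top, h1, ← mul_assoc,
    ← ENNReal.ofReal_mul (by positivity)]
  congr 2
  rw [Real.rpow_add hc, Real.rpow_natCast]
  field_simp

/-! ### Lipschitz functions have finite energy for all exponents -/

theorem min_one_le_rpow {r s : ℝ} (hr : 0 < r) (hs0 : 0 < s) (hs1 : s < 1) :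
    min 1 r ≤ r ^ s := by
  rcases le_total r 1 with h | h
  · rw [min_eq_right h]
    exact Real.self_le_rpow_of_le_one hr.le h hs1.le
  · rw [min_eq_left h]
    exact Real.one_le_rpow h hs0.le

/-- The majorant is independent of `q` in `[1, P]`, as dominated convergence requires. With `r = |x
- y|`, the extra factor `(min 1 r) ^ (q - 1)` absorbs the extra singularity `r ^ (s (q - 1))`
because `min 1 r ≤ r ^ s`. -/
theorem gagliardoIntegrand_le_truncKernel {n : ℕ} {s q P M : ℝ} (hs0 : 0 < s) (hs1 : s < 1)
    (hq : 1 ≤ q) (hqP : q ≤ P) (hM : 1 ≤ M) {ψ : Rn n → ℝ} {x y : Rn n}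
    (hψ : |ψ x - ψ y| ≤ M * min 1 ‖x - y‖) :
    gagliardoIntegrand s q ψ x y ≤
      ENNReal.ofReal (M ^ P) * ENNReal.ofReal (truncKernel n s 1 (x - y)) := by
  rw [← ENNReal.ofReal_mul (by positivity)]
  unfold gagliardoIntegrand truncKernel
  apply ENNReal.ofReal_le_ofReal
  rcases (norm_nonneg (x - y)).eq_or_lt with h0 | hr
  · have hxy : x = y := by rw [← sub_eq_zero, ← norm_eq_zero, ← h0]
    subst hxy
    simp [Real.zero_rpow (by linarith : q ≠ 0)]
  set r := ‖x - y‖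
  rw [one_mul]
  set m := min 1 r
  have hm0 : 0 < m := lt_min one_pos hr
  have h1 : |ψ x - ψ y| ^ q ≤ M ^ P * m ^ q := by
    calc |ψ x - ψ y| ^ q ≤ (M * m) ^ q := by gcongr
      _ = M ^ q * m ^ q := Real.mul_rpow (by linarith) hm0.le
      _ ≤ M ^ P * m ^ q := by gcongr
  have h2 : m ^ q / r ^ ((n : ℝ) + s * q) ≤ m / r ^ ((n : ℝ) + s) := by
    rw [div_le_div_iff₀ (by positivity) (by positivity)]
    have e1 : m ^ q = m * m ^ (q - 1) := by
      rw [← Real.rpow_one_add' hm0.le (by linarith)]; congr 1; ring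
    have e2 : r ^ ((n : ℝ) + s * q) = r ^ ((n : ℝ) + s) * (r ^ s) ^ (q - 1) := by
      rw [← Real.rpow_mul hr.le, ← Real.rpow_add hr]; congr 1; ring
    rw [e1, e2]
    have : m ^ (q - 1) ≤ (r ^ s) ^ (q - 1) :=
      Real.rpow_le_rpow hm0.le (min_one_le_rpow hr hs0 hs1) (by linarith)
    calc m * m ^ (q - 1) * r ^ ((n : ℝ) + s) ≤ m * (r ^ s) ^ (q - 1) * r ^ ((n : ℝ) + s) := by
          gcongr
      _ = _ := by ring
  calc |ψ x - ψ y| ^ q / r ^ ((n : ℝ) + s * q)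
      ≤ M ^ P * m ^ q / r ^ ((n : ℝ) + s * q) := by gcongr
    _ = M ^ P * (m ^ q / r ^ ((n : ℝ) + s * q)) := by ring
    _ ≤ _ := by gcongr

theorem setLIntegral_prod_univ_sub {n : ℕ} {Ω : Set (Rn n)}
    {k : Rn n → ℝ≥0∞} (hk : Measurable k) :
    ∫⁻ z in Ω ×ˢ (univ : Set (Rn n)), k (z.1 - z.2) = volume Ω * ∫⁻ h, k h := by
  rw [Measure.volume_eq_prod, ← Measure.prod_restrict, Measure.restrict_univ,
    lintegral_prod _ (by fun_prop)]
  simp_rw [lintegral_sub_left_eq_self k]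
  simp [mul_comm]

theorem setLIntegral_univ_prod_sub {n : ℕ} {Ω : Set (Rn n)}
    {k : Rn n → ℝ≥0∞} (hk : Measurable k) :
    ∫⁻ z in (univ : Set (Rn n)) ×ˢ Ω, k (z.1 - z.2) = volume Ω * ∫⁻ h, k h := by
  rw [Measure.volume_eq_prod, ← Measure.prod_restrict, Measure.restrict_univ,
    lintegral_prod_symm _ (by fun_prop)]
  simp_rw [lintegral_sub_right_eq_self k]
  simp [mul_comm]

theorem Q_subset {n : ℕ} (Ω : Set (Rn n)) : Q Ω ⊆ Ω ×ˢ univ ∪ univ ×ˢ Ω := by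
  intro z hz
  simp only [Q, mem_compl_iff, mem_prod, not_and, not_not] at hz
  by_cases h : z.1 ∈ Ω
  · exact Or.inl ⟨h, mem_univ _⟩
  · exact Or.inr ⟨mem_univ _, hz h⟩

theorem setLIntegral_Q_truncKernel_lt_top {n : ℕ} (hn : 1 ≤ n) {s : ℝ} (hs0 : 0 < s)
    (hs1 : s < 1) {Ω : Set (Rn n)} (hΩ : volume Ω < ⊤) :
    ∫⁻ z in Q Ω, ENNReal.ofReal (truncKernel n s 1 (z.1 - z.2)) < ⊤ := by
  have hm := (measurable_truncKernel n s 1).ennreal_ofReal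
  calc _ ≤ ∫⁻ z in Ω ×ˢ univ ∪ univ ×ˢ Ω, ENNReal.ofReal (truncKernel n s 1 (z.1 - z.2)) :=
        lintegral_mono_set (Q_subset Ω)
    _ ≤ _ := lintegral_union_le _ _ _
    _ < ⊤ := by
      rw [setLIntegral_prod_univ_sub hm, setLIntegral_univ_prod_sub hm]
      have := ENNReal.mul_lt_top hΩ (lintegral_truncKernel_one_lt_top hn hs0 hs1)
      exact ENNReal.add_lt_top.2 ⟨this, this⟩

/-! ### Continuity of translations and mollification in the Gagliardo seminorm -/

theorem tendsto_translate_L1 {E : Type*} [NormedAddCommGroup E] [NormedSpace ℝ E]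
    [FiniteDimensional ℝ E] [MeasurableSpace E] [BorelSpace E] (μ : Measure E)
    [μ.IsAddHaarMeasure] {F : E → ℝ} (hF : Integrable F μ) :
    Tendsto (fun h => ∫⁻ z, ‖F (z - h) - F z‖ₑ ∂μ) (𝓝 0) (𝓝 0) := by
  have : Fact ((1 : ℝ≥0∞) ≠ ⊤) := ⟨ENNReal.one_ne_top⟩
  have hL : MemLp F 1 μ := memLp_one_iff_integrable.2 hF
  -- Translation acts continuously on `L¹`. `DomAddAct` precomposes with addition, so `-h` yields `F
  -- (z - h)`.
  have hcont : Continuous fun h : E => (DomAddAct.mk (-h)) +ᵥ hL.toLp := by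
    have h1 : Continuous fun h : E => DomAddAct.mk (-h) :=
      DomAddAct.continuous_mk.comp continuous_neg
    exact h1.vadd continuous_const
  have h0 := (hcont.edist continuous_const (g := fun _ => hL.toLp)).tendsto 0
  have hz : (DomAddAct.mk (-(0 : E))) +ᵥ hL.toLp = hL.toLp := by
    simp
  rw [hz, edist_self] at h0
  refine h0.congr fun h => ?_
  rw [DomAddAct.mk_vadd_toLp, Lp.edist_toLp_toLp, eLpNorm_one_eq_lintegral_enorm]
  refine lintegral_congr fun z => ?_
  simp [sub_eq_neg_add]

theorem enorm_sub_div_eq_gagliardoIntegrand {n : ℕ} (s : ℝ) (u : Rn n → ℝ) (x y : Rn n) :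
    ‖(u x - u y) / ‖x - y‖ ^ ((n : ℝ) + s * 1)‖ₑ = gagliardoIntegrand s 1 u x y := by
  rw [gagliardoIntegrand, Real.rpow_one, Real.enorm_eq_ofReal_abs, abs_div,
    abs_of_nonneg (by positivity : 0 ≤ ‖x - y‖ ^ ((n : ℝ) + s * 1))]

/-- The seminorm is the `L¹` norm of `F(x, y) = (ψ x - ψ y) / |x - y|^(n+s)` on the product space.
The weight is invariant under the diagonal translation `(h, h)`, so continuity of translations in
`L¹` applies to `F`. -/
theorem tendsto_gagliardo_translate {n : ℕ} (s : ℝ) {ψ : Rn n → ℝ} (hψ : Measurable ψ)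
    (hfin : ∫⁻ z : Rn n × Rn n, gagliardoIntegrand s 1 ψ z.1 z.2 < ⊤) :
    Tendsto (fun h => ∫⁻ z : Rn n × Rn n,
      gagliardoIntegrand s 1 (fun x => ψ (x - h) - ψ x) z.1 z.2) (𝓝 0) (𝓝 0) := by
  set F : Rn n × Rn n → ℝ := fun z => (ψ z.1 - ψ z.2) / ‖z.1 - z.2‖ ^ ((n : ℝ) + s * 1)
  have hF : Integrable F := by
    refine ⟨by fun_prop, ?_⟩
    rw [hasFiniteIntegral_iff_enorm]
    simpa only [F, enorm_sub_div_eq_gagliardoIntegrand] using hfin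
  have hc : Tendsto (fun h : Rn n => (h, h)) (𝓝 0) (𝓝 (0 : Rn n × Rn n)) :=
    Continuous.tendsto (by fun_prop) 0
  have : (volume : Measure (Rn n × Rn n)).IsAddHaarMeasure :=
    inferInstanceAs ((volume : Measure (Rn n)).prod volume).IsAddHaarMeasure
  refine ((tendsto_translate_L1 volume hF).comp hc).congr fun h => ?_
  refine lintegral_congr fun z => ?_
  rw [← enorm_sub_div_eq_gagliardoIntegrand]
  simp only [F, Prod.fst_sub, Prod.snd_sub, sub_sub_sub_cancel_right]
  congr 1
  ring

/-- Mollification: an integrable function of finite Gagliardo seminorm is approximated in the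
seminorm by bounded Lipschitz functions, with control of the supports. -/
theorem exists_lipschitz_gagliardo_approx {n : ℕ} (s : ℝ) {ψ : Rn n → ℝ} (hψ : Measurable ψ)
    (hint : Integrable ψ)
    (hfin : ∫⁻ z : Rn n × Rn n, gagliardoIntegrand s 1 ψ z.1 z.2 < ⊤)
    {ε : ℝ≥0∞} (hε : 0 < ε) {δ : ℝ} (hδ : 0 < δ) :
    ∃ (ψ' : Rn n → ℝ) (M : ℝ), 1 ≤ M ∧ (∀ x y, |ψ' x - ψ' y| ≤ M * min 1 ‖x - y‖) ∧
      (∀ x, |ψ' x| ≤ M) ∧ (∀ x, (∀ h, ‖h‖ < δ → ψ (x - h) = 0) → ψ' x = 0) ∧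
      ∫⁻ z : Rn n × Rn n, gagliardoIntegrand s 1 (fun x => ψ' x - ψ x) z.1 z.2 ≤ ε := by
  obtain ⟨η, hη, hηε⟩ := Metric.eventually_nhds_iff.1
    ((tendsto_gagliardo_translate s hψ hfin).eventually (ge_mem_nhds hε))
  -- The radius is at most `η`, so that all translations involved have error at most `ε`, and at
  -- most `δ`, to control the support.
  let bump : ContDiffBump (0 : Rn n) :=
    ⟨min η δ / 2, min η δ, by positivity, half_lt_self (by positivity)⟩
  set ρ : Rn n → ℝ := bump.normed volume
  have hρc : Continuous ρ := bump.continuous_normed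
  have hρ0 : ∀ h, 0 ≤ ρ h := bump.nonneg_normed
  have hρint : Integrable ρ := bump.integrable_normed
  have hρ1 : ∫ h, ρ h = 1 := bump.integral_normed
  have hρs : ∀ h, min η δ ≤ ‖h‖ → ρ h = 0 := by
    intro h hh
    have : h ∉ Function.support ρ := by
      rw [bump.support_normed_eq, Metric.mem_ball, dist_zero_right]
      exact not_lt.2 hh
    simpa using this
  obtain ⟨R, hR⟩ : ∃ R, ∀ h, ‖ρ h‖ ≤ R :=
    bump.hasCompactSupport_normed.exists_bound_of_continuous hρc
  obtain ⟨L, hL⟩ : ∃ L, LipschitzWith L ρ :=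
    ContDiff.lipschitzWith_of_hasCompactSupport bump.hasCompactSupport_normed
      (bump.contDiff_normed (n := 1)) (by simp)
  have hψx : ∀ x, Integrable fun h => ψ (x - h) := fun x => hint.comp_sub_left x
  have hρψ : ∀ x, Integrable fun h => ρ h * ψ (x - h) := fun x =>
    (hψx x).bdd_mul hρc.aestronglyMeasurable (.of_forall hR)
  have hρψ' : ∀ x, Integrable fun y => ρ (x - y) * ψ y := fun x =>
    hint.bdd_mul (by fun_prop) (.of_forall fun y => hR _)
  set ψ' : Rn n → ℝ := fun x => ∫ h, ρ h * ψ (x - h)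
  have hψ'eq : ∀ x, ψ' x = ∫ y, ρ (x - y) * ψ y := by
    intro x
    have := integral_sub_left_eq_self (fun h => ρ h * ψ (x - h)) volume x
    simp only [sub_sub_cancel] at this
    exact this.symm
  set I := ∫ y, |ψ y|
  have hI : 0 ≤ I := integral_nonneg fun _ => abs_nonneg _
  have hR0 : 0 ≤ R := (norm_nonneg _).trans (hR 0)
  have hbd : ∀ x, |ψ' x| ≤ R * I := by
    intro x
    rw [hψ'eq, ← Real.norm_eq_abs, ← integral_const_mul]
    refine norm_integral_le_of_norm_le (hint.abs.const_mul R) (.of_forall fun y => ?_)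
    rw [norm_mul]
    exact mul_le_mul_of_nonneg_right (hR _) (norm_nonneg _)
  have hlip : ∀ x y, |ψ' x - ψ' y| ≤ (L * ‖x - y‖) * I := by
    intro x y
    rw [hψ'eq, hψ'eq, ← integral_sub (hρψ' x) (hρψ' y), ← Real.norm_eq_abs,
      ← integral_const_mul]
    refine norm_integral_le_of_norm_le (hint.abs.const_mul _) (.of_forall fun z => ?_)
    rw [← sub_mul, norm_mul]
    refine mul_le_mul_of_nonneg_right ?_ (norm_nonneg _)
    have := hL.dist_le_mul (x - z) (y - z)
    rwa [dist_eq_norm, dist_sub_right, dist_eq_norm] at this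
  -- The summand 1 gives `1 ≤ M`, `L * I` is a Lipschitz constant, and `2 * (R * I)` bounds the
  -- oscillation.
  refine ⟨ψ', 1 + L * I + 2 * (R * I), ?_, ?_, ?_, ?_, ?_⟩
  · have : 0 ≤ L * I := by positivity
    have : 0 ≤ R * I := by positivity
    linarith
  · intro x y
    have hLI : 0 ≤ L * I := by positivity
    have hRI : 0 ≤ R * I := by positivity
    rw [mul_min_of_nonneg _ _ (by linarith), mul_one]
    refine le_min ?_ ?_
    · have := abs_sub (ψ' x) (ψ' y)
      linarith [hbd x, hbd y]
    · calc _ ≤ (L * ‖x - y‖) * I := hlip x y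
        _ = (L * I) * ‖x - y‖ := by ring
        _ ≤ _ := by gcongr; linarith
  · intro x
    have hLI : 0 ≤ L * I := by positivity
    have hRI : 0 ≤ R * I := by positivity
    linarith [hbd x]
  · intro x hx
    refine integral_eq_zero_of_ae (.of_forall fun h => ?_)
    by_cases hh : ‖h‖ < δ
    · simp [hx h hh]
    · simp [hρs h ((min_le_right _ _).trans (not_lt.1 hh))]
  · have hpt : ∀ z : Rn n × Rn n, gagliardoIntegrand s 1 (fun x => ψ' x - ψ x) z.1 z.2 ≤
        ∫⁻ h, ENNReal.ofReal (ρ h) *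
          gagliardoIntegrand s 1 (fun x => ψ (x - h) - ψ x) z.1 z.2 := by
      intro z
      -- Since `ρ` has mass 1, `ψ' - ψ` is the `ρ`-average of the translation differences; the
      -- triangle inequality for integrals then bounds its seminorm by the average of theirs.
      have key : ((ψ' z.1 - ψ z.1) - (ψ' z.2 - ψ z.2)) / ‖z.1 - z.2‖ ^ ((n : ℝ) + s * 1) =
          ∫ h, ρ h * (((ψ (z.1 - h) - ψ z.1) - (ψ (z.2 - h) - ψ z.2)) /
            ‖z.1 - z.2‖ ^ ((n : ℝ) + s * 1)) := by
        have e1 : ∀ x, ψ' x - ψ x = ∫ h, (ρ h * ψ (x - h) - ρ h * ψ x) := by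
          intro x
          rw [integral_sub (hρψ x) (hρint.mul_const _), integral_mul_const, hρ1, one_mul]
        have e2 : ∀ x, Integrable fun h => ρ h * ψ (x - h) - ρ h * ψ x := fun x =>
          (hρψ x).sub (hρint.mul_const _)
        rw [e1, e1, ← integral_sub (e2 _) (e2 _), ← integral_div]
        congr 1
        ext h
        ring
      rw [← enorm_sub_div_eq_gagliardoIntegrand, key]
      refine (enorm_integral_le_lintegral_enorm _).trans (le_of_eq ?_)
      refine lintegral_congr fun h => ?_
      rw [enorm_mul, ← enorm_sub_div_eq_gagliardoIntegrand, Real.enorm_of_nonneg (hρ0 h)]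
    calc _ ≤ ∫⁻ z : Rn n × Rn n, ∫⁻ h, ENNReal.ofReal (ρ h) *
          gagliardoIntegrand s 1 (fun x => ψ (x - h) - ψ x) z.1 z.2 := lintegral_mono hpt
      _ = ∫⁻ h, ∫⁻ z : Rn n × Rn n, ENNReal.ofReal (ρ h) *
          gagliardoIntegrand s 1 (fun x => ψ (x - h) - ψ x) z.1 z.2 := by
        refine lintegral_lintegral_swap (Measurable.aemeasurable ?_)
        unfold gagliardoIntegrand Function.uncurry
        have := hρc.measurable
        fun_prop
      _ ≤ ∫⁻ h, ENNReal.ofReal (ρ h) * ε := by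
        refine lintegral_mono fun h => ?_
        rw [lintegral_const_mul' _ _ ENNReal.ofReal_ne_top]
        by_cases hh : ‖h‖ < η
        · gcongr
          exact hηε (by simpa using hh)
        · simp [hρs h ((min_le_left _ _).trans (not_lt.1 hh))]
      _ = ε := by
        rw [lintegral_mul_const _ (by fun_prop),
          ← ofReal_integral_eq_lintegral_ofReal hρint (.of_forall hρ0), hρ1]
        simp

/-! ### Exterior balls of Lipschitz domains -/

/-- Locally, move from a boundary point by `t` against the direction `e`: the complement lies below
a Lipschitz graph, so a small ball around the new point stays below it. Compactness of the boundary
makes the constants uniform. -/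
theorem exists_exterior_ball {n : ℕ} {Ω : Set (Rn n)} (hΩo : IsOpen Ω)
    (hΩb : Bornology.IsBounded Ω) (hΩL : HasLipschitzBoundary Ω) :
    ∃ c t₀ : ℝ, 0 < c ∧ c ≤ 1 ∧ 0 < t₀ ∧ ∀ z ∈ frontier Ω, ∀ t, 0 < t → t ≤ t₀ →
      ∃ y, dist y z ≤ t ∧ Metric.ball y (c * t) ⊆ Ωᶜ := by
  have hK : IsCompact (frontier Ω) :=
    Metric.isCompact_of_isClosed_isBounded isClosed_frontier
      (hΩb.closure.subset frontier_subset_closure)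
  have := hK.induction_on (p := fun S => ∃ c t₀ : ℝ, 0 < c ∧ c ≤ 1 ∧ 0 < t₀ ∧
    ∀ z ∈ S ∩ frontier Ω, ∀ t, 0 < t → t ≤ t₀ →
      ∃ y, dist y z ≤ t ∧ Metric.ball y (c * t) ⊆ Ωᶜ) ?_ ?_ ?_ ?_
  · simpa using this
  · exact ⟨1, 1, one_pos, le_rfl, one_pos, by simp⟩
  · rintro S T hST ⟨c, t₀, h1, h2, h3, h4⟩
    exact ⟨c, t₀, h1, h2, h3, fun z hz => h4 z ⟨hST hz.1, hz.2⟩⟩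
  · rintro S T ⟨c, t₀, h1, h2, h3, h4⟩ ⟨c', t₀', h1', h2', h3', h4'⟩
    refine ⟨min c c', min t₀ t₀', lt_min h1 h1', (min_le_left _ _).trans h2, lt_min h3 h3', ?_⟩
    rintro z ⟨hz | hz, hzf⟩ t ht htt
    · obtain ⟨y, hy, hb⟩ := h4 z ⟨hz, hzf⟩ t ht (htt.trans (min_le_left _ _))
      refine ⟨y, hy, (Metric.ball_subset_ball ?_).trans hb⟩
      gcongr
      exact min_le_left _ _
    · obtain ⟨y, hy, hb⟩ := h4' z ⟨hz, hzf⟩ t ht (htt.trans (min_le_right _ _))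
      refine ⟨y, hy, (Metric.ball_subset_ball ?_).trans hb⟩
      gcongr
      exact min_le_right _ _
  · intro x₀ hx₀
    obtain ⟨e, g, L, r, he, hg, hr, hgr⟩ := hΩL x₀ hx₀
    have hLpos : (0 : ℝ) < 1 + 2 * L := by positivity
    -- A displacement `h` changes the height by at most `‖h‖` and the graph by at most `2 * L *
    -- ‖h‖`, so `(1 + 2 * L) * ‖h‖ < t` keeps the point below the graph. The bound `t ≤ r / 8` keeps
    -- everything inside the chart ball.
    refine ⟨Metric.ball x₀ (r / 2),
      mem_nhdsWithin_of_mem_nhds (Metric.ball_mem_nhds _ (by positivity)),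
      1 / (1 + 2 * L), r / 8, by positivity, ?_, by positivity, ?_⟩
    · rw [div_le_one hLpos]
      have : (0 : ℝ) ≤ L := L.2
      linarith
    rintro z ⟨hz, hzf⟩ t ht htr
    refine ⟨z - t • e, by simp [norm_smul, he, abs_of_pos ht], ?_⟩
    intro w hw hwΩ
    have hzΩ : z ∉ Ω := by
      rw [hΩo.frontier_eq] at hzf
      exact hzf.2
    have hz' : dist z x₀ < r / 2 := hz
    have hzge : inner ℝ e z ≤ g (z - inner ℝ e z • e) := by
      by_contra hcon
      exact hzΩ ((hgr z (Metric.mem_ball.2 (by linarith))).2 (not_le.1 hcon))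
    set h := w - (z - t • e) with hh
    have hhn : (1 + 2 * L) * ‖h‖ < t := by
      have : ‖h‖ < 1 / (1 + 2 * L) * t := by simpa [dist_eq_norm] using hw
      rw [one_div_mul_eq_div, lt_div_iff₀ hLpos] at this
      linarith
    have hhn' : ‖h‖ ≤ t := by
      have : 0 ≤ 2 * L * ‖h‖ := by positivity
      linarith
    have hwz : w = z - t • e + h := by rw [hh]; abel
    have hwb : w ∈ Metric.ball x₀ r := by
      rw [Metric.mem_ball]
      have h1 : dist w z ≤ t + t := by
        rw [dist_eq_norm, hwz, show z - t • e + h - z = h - t • e by abel]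
        refine (norm_sub_le _ _).trans ?_
        rw [norm_smul, he, mul_one, Real.norm_of_nonneg ht.le]
        linarith
      linarith [dist_triangle w z x₀]
    have hwlt := (hgr w hwb).1 hwΩ
    have hee : inner ℝ e e = (1 : ℝ) := by rw [real_inner_self_eq_norm_sq, he]; norm_num
    have hiw : inner ℝ e w = inner ℝ e z - t + inner ℝ e h := by
      rw [hwz, inner_add_right, inner_sub_right, inner_smul_right, hee, mul_one]
    have hih : |inner ℝ e h| ≤ ‖h‖ := by
      simpa [he] using abs_real_inner_le_norm e h
    have hdiff : dist (g (w - inner ℝ e w • e)) (g (z - inner ℝ e z • e)) ≤ L * (2 * ‖h‖) := by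
      refine (hg.dist_le_mul _ _).trans ?_
      gcongr
      rw [dist_eq_norm, hiw, hwz, show z - t • e + h - (inner ℝ e z - t + inner ℝ e h) • e -
        (z - inner ℝ e z • e) = h - (inner ℝ e h : ℝ) • e by
          rw [add_smul, sub_smul]; abel]
      refine (norm_sub_le _ _).trans ?_
      rw [norm_smul, he, mul_one, Real.norm_eq_abs]
      linarith
    rw [Real.dist_eq] at hdiff
    have h1 := (abs_le.1 hdiff).1
    have h2 := (abs_le.1 hih).2
    linarith

theorem infDist_compl_pos {n : ℕ} {Ω : Set (Rn n)} (hΩo : IsOpen Ω) (hne : Ωᶜ.Nonempty)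
    {x : Rn n} (hx : x ∈ Ω) : 0 < Metric.infDist x Ωᶜ :=
  (hΩo.isClosed_compl.notMem_iff_infDist_pos hne).1 (by simpa using hx)

/-- At distance `d` from the complement, the nearest exterior point lies on the boundary. The
exterior ball there, of radius comparable to `d`, lies within `3 * d` of `x`, so it contributes a
multiple of `d ^ n * d ^ (-(n + s))`. -/
theorem exists_potential_lower_bound {n : ℕ} (hn : 1 ≤ n) {s : ℝ} (hs0 : 0 < s)
    {Ω : Set (Rn n)} (hΩo : IsOpen Ω) (hΩb : Bornology.IsBounded Ω)
    (hΩL : HasLipschitzBoundary Ω) (hne : Ωᶜ.Nonempty) :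
    ∃ c : ℝ, 0 < c ∧ ∀ x ∈ Ω, ENNReal.ofReal (c * Metric.infDist x Ωᶜ ^ (-s)) ≤
      ∫⁻ y in Ωᶜ, ENNReal.ofReal (1 / ‖x - y‖ ^ ((n : ℝ) + s)) := by
  have : Nonempty (Fin n) := ⟨⟨0, hn⟩⟩
  obtain ⟨c, t₀, hc0, hc1, ht₀, hball⟩ := exists_exterior_ball hΩo hΩb hΩL
  obtain ⟨z₀, hz₀⟩ := hne
  obtain ⟨D, hD⟩ := hΩb.subset_ball z₀
  set D' := max D 1
  have hD'0 : 0 < D' := lt_max_of_lt_right one_pos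
  -- Shrinks `d` to an admissible exterior-ball scale: `τ * d ≤ t₀` for every distance `d ≤ D'`
  -- occurring in `Ω`.
  set τ := min 1 (t₀ / D')
  have hτ0 : 0 < τ := lt_min one_pos (by positivity)
  set ω := (volume (Metric.ball (0 : Rn n) 1)).toReal
  have hω : 0 < ω := ENNReal.toReal_pos (Metric.measure_ball_pos _ _ one_pos).ne'
    measure_ball_lt_top.ne
  refine ⟨(c * τ) ^ n * ω / 3 ^ ((n : ℝ) + s), by positivity, fun x hx => ?_⟩
  have hd := infDist_compl_pos hΩo ⟨z₀, hz₀⟩ hx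
  obtain ⟨z, hz, hxz⟩ := hΩo.isClosed_compl.exists_infDist_eq_dist ⟨z₀, hz₀⟩ x
  set d := Metric.infDist x Ωᶜ with hddef
  have hdD : d ≤ D' := by
    refine (Metric.infDist_le_dist_of_mem hz₀).trans ?_
    exact (Metric.mem_ball.1 (hD hx)).le.trans (le_max_left _ _)
  have hzf : z ∈ frontier Ω := by
    rw [hΩo.frontier_eq]
    refine ⟨?_, hz⟩
    have h1 : Metric.ball x d ⊆ Ω := by
      have := Metric.ball_infDist_compl_subset (s := Ω) (x := x)
      exact this
    have h2 : z ∈ closure (Metric.ball x d) := by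
      rw [closure_ball x hd.ne', Metric.mem_closedBall, dist_comm]
      exact hxz.ge
    exact closure_mono h1 h2
  have hτd : τ * d ≤ d := by
    have := mul_le_mul_of_nonneg_right (min_le_left 1 (t₀ / D')) hd.le
    linarith
  have hτd' : τ * d ≤ t₀ := by
    calc τ * d ≤ (t₀ / D') * D' := by gcongr; exact min_le_right _ _
      _ = t₀ := by field_simp
  obtain ⟨y, hy, hyb⟩ := hball z hzf (τ * d) (by positivity) hτd'
  have hR : 0 < c * (τ * d) := by positivity
  have hRd : c * (τ * d) ≤ d := by
    calc c * (τ * d) ≤ 1 * d := by gcongr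
      _ = d := one_mul d
  calc ENNReal.ofReal ((c * τ) ^ n * ω / 3 ^ ((n : ℝ) + s) * d ^ (-s))
      = ENNReal.ofReal (1 / (3 * d) ^ ((n : ℝ) + s)) * volume (Metric.ball y (c * (τ * d))) := by
        rw [Measure.addHaar_ball _ _ hR.le, finrank_euclideanSpace_fin,
          ← ENNReal.ofReal_toReal (measure_ball_lt_top (μ := volume) (x := (0 : Rn n)) (r := 1)).ne,
          ← ENNReal.ofReal_mul (by positivity), ← ENNReal.ofReal_mul (by positivity)]
        congr 1
        rw [Real.mul_rpow (by norm_num) hd.le, Real.rpow_add hd, Real.rpow_neg hd.le,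
          Real.rpow_natCast]
        simp only [ω]
        field_simp
        ring
    _ = ∫⁻ _ in Metric.ball y (c * (τ * d)), ENNReal.ofReal (1 / (3 * d) ^ ((n : ℝ) + s)) := by
        rw [setLIntegral_const]
    _ ≤ ∫⁻ w in Metric.ball y (c * (τ * d)), ENNReal.ofReal (1 / ‖x - w‖ ^ ((n : ℝ) + s)) := by
        refine setLIntegral_mono (by fun_prop) fun w hw => ENNReal.ofReal_le_ofReal ?_
        have hxw : 0 < ‖x - w‖ := by
          rw [norm_pos_iff, sub_ne_zero]
          rintro rfl
          exact hyb hw hx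
        have hle : ‖x - w‖ ≤ 3 * d := by
          rw [← dist_eq_norm]
          have h1 : dist w y < c * (τ * d) := hw
          have h2 := dist_triangle x z w
          have h3 := dist_triangle z y w
          rw [dist_comm z y, dist_comm y w] at h3
          linarith
        gcongr
    _ ≤ _ := lintegral_mono_set hyb

/-! ### Cutoff near the boundary -/

/-- A function of finite Gagliardo seminorm vanishing outside a Lipschitz domain satisfies a
fractional Hardy bound. -/
theorem lintegral_hardy_lt_top {n : ℕ} (hn : 1 ≤ n) {s : ℝ} (hs0 : 0 < s)
    {Ω : Set (Rn n)} (hΩo : IsOpen Ω) (hΩb : Bornology.IsBounded Ω)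
    (hΩL : HasLipschitzBoundary Ω) (hne : Ωᶜ.Nonempty) {ψ : Rn n → ℝ} (hψ : Measurable ψ)
    (hψ0 : ∀ x ∉ Ω, ψ x = 0)
    (hfin : ∫⁻ z : Rn n × Rn n, gagliardoIntegrand s 1 ψ z.1 z.2 < ⊤) :
    ∫⁻ x, ENNReal.ofReal |ψ x| * ENNReal.ofReal (Metric.infDist x Ωᶜ ^ (-s)) < ⊤ := by
  obtain ⟨c, hc, hcb⟩ := exists_potential_lower_bound hn hs0 hΩo hΩb hΩL hne
  have hpt : ∀ x, ENNReal.ofReal |ψ x| * ENNReal.ofReal (Metric.infDist x Ωᶜ ^ (-s)) ≤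
      ENNReal.ofReal c⁻¹ * ∫⁻ y, gagliardoIntegrand s 1 ψ x y := by
    intro x
    by_cases hx : x ∈ Ω
    -- For `y` outside `Ω` the difference `ψ x - ψ y` is `ψ x`, so the seminorm contains `|ψ x|`
    -- times the potential of the complement, which dominates `d ^ (-s)`.
    · have h1 : ENNReal.ofReal |ψ x| * ∫⁻ y in Ωᶜ, ENNReal.ofReal (1 / ‖x - y‖ ^ ((n : ℝ) + s))
          ≤ ∫⁻ y, gagliardoIntegrand s 1 ψ x y := by
        rw [← lintegral_const_mul' _ _ ENNReal.ofReal_ne_top]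
        refine le_trans (le_of_eq ?_) (setLIntegral_le_lintegral Ωᶜ _)
        refine setLIntegral_congr_fun hΩo.measurableSet.compl fun y hy => ?_
        simp only [gagliardoIntegrand, hψ0 y hy, sub_zero, Real.rpow_one, mul_one]
        rw [← ENNReal.ofReal_mul (abs_nonneg _), mul_one_div]
      calc _ = ENNReal.ofReal c⁻¹ * (ENNReal.ofReal |ψ x| *
            ENNReal.ofReal (c * Metric.infDist x Ωᶜ ^ (-s))) := by
            rw [← ENNReal.ofReal_mul (by positivity), ← ENNReal.ofReal_mul (by positivity),
              ← ENNReal.ofReal_mul (by positivity)]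
            congr 1
            field_simp
        _ ≤ ENNReal.ofReal c⁻¹ * (ENNReal.ofReal |ψ x| *
            ∫⁻ y in Ωᶜ, ENNReal.ofReal (1 / ‖x - y‖ ^ ((n : ℝ) + s))) := by
            gcongr
            exact hcb x hx
        _ ≤ _ := by gcongr
    · simp [hψ0 x hx]
  refine (lintegral_mono hpt).trans_lt ?_
  rw [lintegral_const_mul' _ _ ENNReal.ofReal_ne_top]
  refine ENNReal.mul_lt_top ENNReal.ofReal_lt_top ?_
  rwa [Measure.volume_eq_prod,
    lintegral_prod _ (aemeasurable_gagliardoIntegrand s 1 hψ.aemeasurable)] at hfin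

/-- The cutoff `min(1, (d/δ - 1)⁺)`, where `d` is the distance from the complement of `Ω`. -/
noncomputable def cutoff {n : ℕ} (Ω : Set (Rn n)) (δ : ℝ) (x : Rn n) : ℝ :=
  max 0 (min 1 (Metric.infDist x Ωᶜ / δ - 1))

theorem measurable_cutoff {n : ℕ} (Ω : Set (Rn n)) (δ : ℝ) : Measurable (cutoff Ω δ) := by
  have : Continuous fun x => Metric.infDist x Ωᶜ := Metric.continuous_infDist_pt _
  have := this.measurable
  unfold cutoff
  fun_prop

theorem cutoff_nonneg {n : ℕ} (Ω : Set (Rn n)) (δ : ℝ) (x : Rn n) : 0 ≤ cutoff Ω δ x :=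
  le_max_left _ _

theorem cutoff_le_one {n : ℕ} (Ω : Set (Rn n)) (δ : ℝ) (x : Rn n) : cutoff Ω δ x ≤ 1 :=
  max_le zero_le_one (min_le_left _ _)

theorem cutoff_eq_zero {n : ℕ} {Ω : Set (Rn n)} {δ : ℝ} (hδ : 0 < δ) {x : Rn n}
    (hx : Metric.infDist x Ωᶜ ≤ δ) : cutoff Ω δ x = 0 := by
  refine max_eq_left ((min_le_right _ _).trans ?_)
  rw [sub_nonpos, div_le_one hδ]
  exact hx

theorem cutoff_eq_one {n : ℕ} {Ω : Set (Rn n)} {δ : ℝ} (hδ : 0 < δ) {x : Rn n}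
    (hx : 2 * δ ≤ Metric.infDist x Ωᶜ) : cutoff Ω δ x = 1 := by
  have : 1 ≤ Metric.infDist x Ωᶜ / δ - 1 := by
    rw [le_sub_iff_add_le, le_div_iff₀ hδ]
    linarith
  rw [cutoff, min_eq_left this, max_eq_right zero_le_one]

/-- The bound is uniform in `δ`. If `d ≤ 4 * δ`, the slope `1 / δ` is at most `4 / d`. If `d ≥ 4 *
δ`, the cutoff is 1 at `x`; either it is 1 at `y` too, or `y` is at distance at least `d / 2`. -/
theorem abs_cutoff_sub_le {n : ℕ} {Ω : Set (Rn n)} {δ : ℝ} (hδ : 0 < δ) {x y : Rn n}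
    (hx : 0 < Metric.infDist x Ωᶜ) :
    |cutoff Ω δ x - cutoff Ω δ y| ≤ min 1 (4 / Metric.infDist x Ωᶜ * ‖x - y‖) := by
  set d := Metric.infDist x Ωᶜ with hd
  have hle1 : |cutoff Ω δ x - cutoff Ω δ y| ≤ 1 := by
    rw [abs_le]
    constructor <;> linarith [cutoff_nonneg Ω δ x, cutoff_nonneg Ω δ y, cutoff_le_one Ω δ x,
      cutoff_le_one Ω δ y]
  have hdl : |Metric.infDist x Ωᶜ - Metric.infDist y Ωᶜ| ≤ ‖x - y‖ := by
    have := (Metric.lipschitz_infDist_pt Ωᶜ).dist_le_mul x y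
    rwa [NNReal.coe_one, one_mul, Real.dist_eq, dist_eq_norm] at this
  refine le_min hle1 ?_
  rcases le_total d (4 * δ) with h | h
  · have h1 : |cutoff Ω δ x - cutoff Ω δ y| ≤
        |Metric.infDist x Ωᶜ / δ - 1 - (Metric.infDist y Ωᶜ / δ - 1)| :=
      (abs_max_sub_max_le_max _ _ _ _).trans (max_le (by simp)
        ((abs_min_sub_min_le_max _ _ _ _).trans (max_le (by simp) le_rfl)))
    refine h1.trans ?_
    rw [sub_sub_sub_cancel_right, ← sub_div, abs_div, abs_of_pos hδ, div_mul_eq_mul_div,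
      div_le_div_iff₀ hδ hx]
    calc _ ≤ ‖x - y‖ * (4 * δ) := by gcongr
      _ = _ := by ring
  · by_cases hy : 2 * δ ≤ Metric.infDist y Ωᶜ
    · rw [cutoff_eq_one hδ hy, cutoff_eq_one hδ (by linarith)]
      simp only [sub_self, abs_zero]
      positivity
    · refine hle1.trans ?_
      rw [div_mul_eq_mul_div, one_le_div hx]
      have := (abs_le.1 hdl).2
      linarith

/-- Dominated convergence as `δ → 0`. The majorant is the integrand of `ψ` plus `H`; integrating `H`
in `y` gives, by scaling of the truncated kernel, a multiple of `|ψ x| * d(x) ^ (-s)`, which the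
Hardy bound makes integrable. -/
theorem exists_cutoff_gagliardo_le {n : ℕ} (hn : 1 ≤ n) {s : ℝ} (hs0 : 0 < s) (hs1 : s < 1)
    {Ω : Set (Rn n)} (hΩo : IsOpen Ω) (hΩb : Bornology.IsBounded Ω)
    (hΩL : HasLipschitzBoundary Ω) (hne : Ωᶜ.Nonempty) {ψ : Rn n → ℝ} (hψ : Measurable ψ)
    (hψ0 : ∀ x ∉ Ω, ψ x = 0)
    (hfin : ∫⁻ z : Rn n × Rn n, gagliardoIntegrand s 1 ψ z.1 z.2 < ⊤) {ε : ℝ≥0∞} (hε : 0 < ε) :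
    ∃ δ : ℝ, 0 < δ ∧
      ∫⁻ z : Rn n × Rn n,
        gagliardoIntegrand s 1 (fun x => ψ x * cutoff Ω δ x - ψ x) z.1 z.2 ≤ ε := by
  set δ : ℕ → ℝ := fun m => 1 / ((m : ℝ) + 1)
  have hδ0 : ∀ m, 0 < δ m := fun m => by positivity
  have hδ : Tendsto δ atTop (𝓝 0) := tendsto_one_div_add_atTop_nhds_zero_nat
  set w : ℕ → Rn n → ℝ := fun m x => ψ x * cutoff Ω (δ m) x - ψ x
  have hw : ∀ m, Measurable (w m) := fun m => (hψ.mul (measurable_cutoff Ω _)).sub hψ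
  set H : Rn n × Rn n → ℝ≥0∞ := fun z => ENNReal.ofReal |ψ z.1| *
    ENNReal.ofReal (truncKernel n s (4 / Metric.infDist z.1 Ωᶜ) (z.1 - z.2))
  have hHm : Measurable H := by
    have : Measurable fun x : Rn n => Metric.infDist x Ωᶜ :=
      (Metric.continuous_infDist_pt _).measurable
    simp only [H, truncKernel]
    fun_prop
  have hHfin : ∫⁻ z, H z < ⊤ := by
    rw [Measure.volume_eq_prod, lintegral_prod _ hHm.aemeasurable]
    set K := ∫⁻ h, ENNReal.ofReal (truncKernel n s 1 h)
    have hK : K < ⊤ := lintegral_truncKernel_one_lt_top hn hs0 hs1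
    have hpt : ∀ x, ∫⁻ y, H (x, y) ≤ (ENNReal.ofReal (4 ^ s) * K) *
        (ENNReal.ofReal |ψ x| * ENNReal.ofReal (Metric.infDist x Ωᶜ ^ (-s))) := by
      intro x
      simp only [H]
      rw [lintegral_const_mul' _ _ ENNReal.ofReal_ne_top]
      by_cases hx : x ∈ Ω
      · have hd := infDist_compl_pos hΩo hne hx
        rw [lintegral_sub_left_eq_self (fun h => ENNReal.ofReal
          (truncKernel n s (4 / Metric.infDist x Ωᶜ) h)), lintegral_truncKernel n s (by positivity),
          Real.div_rpow (by norm_num) hd.le, Real.rpow_neg hd.le, div_eq_mul_inv,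
          ENNReal.ofReal_mul (by positivity)]
        exact le_of_eq (by ring)
      · simp [hψ0 x hx]
    refine (lintegral_mono hpt).trans_lt ?_
    rw [lintegral_const_mul' _ _ (ENNReal.mul_lt_top ENNReal.ofReal_lt_top hK).ne]
    exact ENNReal.mul_lt_top (ENNReal.mul_lt_top ENNReal.ofReal_lt_top hK)
      (lintegral_hardy_lt_top hn hs0 hΩo hΩb hΩL hne hψ hψ0 hfin)
  have hψG := aemeasurable_gagliardoIntegrand s 1 (μ := volume) hψ.aemeasurable
  have hbound : ∀ m (z : Rn n × Rn n), gagliardoIntegrand s 1 (w m) z.1 z.2 ≤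
      gagliardoIntegrand s 1 ψ z.1 z.2 + H z := by
    rintro m ⟨x, y⟩
    simp only [gagliardoIntegrand, H, truncKernel, Real.rpow_one, mul_one]
    rw [← ENNReal.ofReal_mul (abs_nonneg _),
      ← ENNReal.ofReal_add (by positivity) (by have := Metric.infDist_nonneg (x := x) (s := Ωᶜ);
                                               positivity), ← mul_div_assoc, ← add_div]
    apply ENNReal.ofReal_le_ofReal
    gcongr
    -- Discrete Leibniz rule: one term is controlled by the difference of `ψ`, the other by that of
    -- the cutoff.
    have e : w m x - w m y = (1 - cutoff Ω (δ m) y) * (ψ y - ψ x) +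
        ψ x * (cutoff Ω (δ m) x - cutoff Ω (δ m) y) := by simp only [w]; ring
    rw [e]
    refine (abs_add_le _ _).trans (add_le_add ?_ ?_)
    · rw [abs_mul, abs_sub_comm (ψ y)]
      refine mul_le_of_le_one_left (abs_nonneg _) ?_
      rw [abs_le]
      constructor <;> linarith [cutoff_nonneg Ω (δ m) y, cutoff_le_one Ω (δ m) y]
    · rw [abs_mul]
      by_cases hx : x ∈ Ω
      · gcongr
        exact abs_cutoff_sub_le (hδ0 m) (infDist_compl_pos hΩo hne hx)
      · simp [hψ0 x hx]
  have hlim0 : ∀ x, Tendsto (fun m => w m x) atTop (𝓝 0) := by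
    intro x
    by_cases hx : x ∈ Ω
    · have hd := infDist_compl_pos hΩo hne hx
      refine tendsto_const_nhds.congr' ?_
      filter_upwards [hδ.eventually (ge_mem_nhds (half_pos hd))] with m hm
      simp only [w]
      rw [cutoff_eq_one (hδ0 m) (by linarith)]
      ring
    · simp [w, hψ0 x hx]
  have hconv := tendsto_lintegral_of_dominated_convergence'
    (μ := (volume : Measure (Rn n × Rn n)))
    (F := fun m z => gagliardoIntegrand s 1 (w m) z.1 z.2) (f := fun _ => 0)
    (fun z => gagliardoIntegrand s 1 ψ z.1 z.2 + H z)
    (fun m => aemeasurable_gagliardoIntegrand s 1 (hw m).aemeasurable)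
    (fun m => .of_forall (hbound m)) ?_ ?_
  · rw [lintegral_zero] at hconv
    obtain ⟨m, hm⟩ := (hconv.eventually (ge_mem_nhds hε)).exists
    exact ⟨δ m, hδ0 m, hm⟩
  · rw [lintegral_add_right _ hHm]
    exact (ENNReal.add_lt_top.2 ⟨hfin, hHfin⟩).ne
  · refine .of_forall fun z => ?_
    have := tendsto_gagliardoIntegrand s (q := fun _ => 1) (v := fun _ => 0) one_pos
      tendsto_const_nhds (fun _ => one_pos) (hlim0 z.1) (hlim0 z.2)
    simpa [gagliardoIntegrand] using this

/-- Density of Lipschitz functions vanishing outside `Ω`. -/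
theorem exists_lipschitz_approx {n : ℕ} (hn : 1 ≤ n) {s : ℝ} (hs0 : 0 < s) (hs1 : s < 1)
    {Ω : Set (Rn n)} (hΩo : IsOpen Ω) (hΩb : Bornology.IsBounded Ω)
    (hΩL : HasLipschitzBoundary Ω) (hne : Ωᶜ.Nonempty) {ψ : Rn n → ℝ} (hψ : Measurable ψ)
    (hint : Integrable ψ) (hψ0 : ∀ x ∉ Ω, ψ x = 0)
    (hfin : ∫⁻ z : Rn n × Rn n, gagliardoIntegrand s 1 ψ z.1 z.2 < ⊤) {ε : ℝ≥0∞} (hε : 0 < ε) :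
    ∃ (ψ' : Rn n → ℝ) (M : ℝ), 1 ≤ M ∧ (∀ x y, |ψ' x - ψ' y| ≤ M * min 1 ‖x - y‖) ∧
      (∀ x, |ψ' x| ≤ M) ∧ (∀ x ∉ Ω, ψ' x = 0) ∧
      ∫⁻ z : Rn n × Rn n, gagliardoIntegrand s 1 (fun x => ψ' x - ψ x) z.1 z.2 ≤ ε := by
  -- The cap 1 keeps the error finite even for `ε = ⊤`, so that the cut function has finite
  -- seminorm.
  have hε2 : 0 < min (ε / 2) 1 := lt_min (ENNReal.half_pos hε.ne') one_pos
  obtain ⟨δ, hδ, hδε⟩ := exists_cutoff_gagliardo_le hn hs0 hs1 hΩo hΩb hΩL hne hψ hψ0 hfin hε2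
  set ψ₁ : Rn n → ℝ := fun x => ψ x * cutoff Ω δ x
  have hψ₁ : Measurable ψ₁ := hψ.mul (measurable_cutoff Ω δ)
  have hint₁ : Integrable ψ₁ := by
    refine hint.mono hψ₁.aestronglyMeasurable (.of_forall fun x => ?_)
    rw [norm_mul]
    refine mul_le_of_le_one_right (norm_nonneg _) ?_
    rw [Real.norm_of_nonneg (cutoff_nonneg Ω δ x)]
    exact cutoff_le_one Ω δ x
  have hfin₁ : ∫⁻ z : Rn n × Rn n, gagliardoIntegrand s 1 ψ₁ z.1 z.2 < ⊤ := by
    have e : ψ₁ = ψ + fun x => ψ₁ x - ψ x := by ext x; simp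
    rw [e]
    refine (lintegral_gagliardoIntegrand_add_le s
      (aemeasurable_gagliardoIntegrand_volume s 1 hψ.aemeasurable) _).trans_lt (ENNReal.add_lt_top.2 ⟨hfin, ?_⟩)
    exact (hδε.trans (min_le_right _ _)).trans_lt ENNReal.one_lt_top
  -- The cut function vanishes within distance `δ` of the complement, so mollifying at radius at
  -- most `δ` keeps it zero outside `Ω`.
  obtain ⟨ψ', M, hM, hlip, hbd, hsupp, happ⟩ :=
    exists_lipschitz_gagliardo_approx s hψ₁ hint₁ hfin₁ (ENNReal.half_pos hε.ne') hδ
  refine ⟨ψ', M, hM, hlip, hbd, fun x hx => hsupp x fun h hh => ?_, ?_⟩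
  · have : Metric.infDist (x - h) Ωᶜ ≤ δ :=
      (Metric.infDist_le_dist_of_mem (mem_compl hx)).trans (by simpa using hh.le)
    simp only [ψ₁]
    rw [cutoff_eq_zero hδ this, mul_zero]
  · have e : (fun x => ψ' x - ψ x) = (fun x => ψ₁ x - ψ x) + fun x => ψ' x - ψ₁ x := by
      ext x; simp
    rw [e]
    refine (lintegral_gagliardoIntegrand_add_le s
      (aemeasurable_gagliardoIntegrand_volume s 1 (hψ₁.sub hψ).aemeasurable) _).trans ?_
    calc _ ≤ ε / 2 + ε / 2 := add_le_add (hδε.trans (min_le_left _ _)) happ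
      _ = ε := ENNReal.add_halves ε

/-! ### Compactness in `L¹` of functions with bounded seminorms of varying exponent -/

theorem le_add_rpow_mul_rpow {a l q : ℝ} (ha : 0 ≤ a) (hl : 0 < l) (hq : 1 ≤ q) :
    a ≤ l + l ^ (1 - q) * a ^ q := by
  rcases le_total a l with h | h
  · have : 0 ≤ l ^ (1 - q) * a ^ q := by positivity
    linarith
  · have ha0 : 0 < a := hl.trans_le h
    have h1 : a ^ (1 - q) ≤ l ^ (1 - q) := Real.rpow_le_rpow_of_nonpos hl h (by linarith)
    have h2 : a = a ^ (1 - q) * a ^ q := by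
      rw [← Real.rpow_add ha0]; simp
    have h3 : a ^ (1 - q) * a ^ q ≤ l ^ (1 - q) * a ^ q := by gcongr
    linarith

/-- With the threshold `l = r ^ s`, `r = |x - y|`, the weight becomes `r ^ (s (1 - q)) * r ^ (n + s
q) = r ^ (n + s)`: the exponent `q` disappears from the constants. -/
theorem abs_sub_le_gagliardoIntegrand {n : ℕ} {s q ρ : ℝ} (hs0 : 0 < s) (hq : 1 ≤ q)
    (w : Rn n → ℝ) {x y : Rn n} (hxy : ‖x - y‖ ≤ ρ) :
    ENNReal.ofReal |w x - w y| ≤ ENNReal.ofReal (ρ ^ s) +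
      ENNReal.ofReal (ρ ^ ((n : ℝ) + s)) * gagliardoIntegrand s q w x y := by
  rcases (norm_nonneg (x - y)).eq_or_lt with h0 | hr
  · have hxy : x = y := by rw [← sub_eq_zero, ← norm_eq_zero, ← h0]
    simp [hxy]
  have hρ : 0 < ρ := hr.trans_le hxy
  unfold gagliardoIntegrand
  rw [← ENNReal.ofReal_mul (by positivity), ← ENNReal.ofReal_add (by positivity) (by positivity)]
  apply ENNReal.ofReal_le_ofReal
  set r := ‖x - y‖
  refine (le_add_rpow_mul_rpow (abs_nonneg _) (Real.rpow_pos_of_pos hr s) hq).trans ?_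
  have e : (r ^ s) ^ (1 - q) = r ^ ((n : ℝ) + s) / r ^ ((n : ℝ) + s * q) := by
    rw [← Real.rpow_mul hr.le, ← Real.rpow_sub hr]; congr 1; ring
  rw [e, div_mul_eq_mul_div, mul_div_assoc]
  gcongr

theorem setLIntegral_abs_sub_le {n : ℕ} {s q ρ : ℝ} (hs0 : 0 < s) (hq : 1 ≤ q)
    {w : Rn n → ℝ} (hw : AEMeasurable w) {S A : Set (Rn n)} (hS : MeasurableSet S)
    (hA : MeasurableSet A) (hSA : ∀ x ∈ S, ∀ y ∈ A, ‖x - y‖ ≤ ρ) :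
    ∫⁻ x in S, ∫⁻ y in A, ENNReal.ofReal |w x - w y| ≤
      ENNReal.ofReal (ρ ^ s) * volume A * volume S + ENNReal.ofReal (ρ ^ ((n : ℝ) + s)) *
        ∫⁻ z in S ×ˢ A, gagliardoIntegrand s q w z.1 z.2 := by
  have hG := aemeasurable_gagliardoIntegrand_volume s q hw
  rw [Measure.volume_eq_prod] at hG
  have hGr : AEMeasurable (fun z : Rn n × Rn n => gagliardoIntegrand s q w z.1 z.2)
      ((volume.restrict S).prod (volume.restrict A)) := by
    rw [Measure.prod_restrict]; exact hG.restrict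
  calc _ ≤ ∫⁻ x in S, ∫⁻ y in A, (ENNReal.ofReal (ρ ^ s) +
      ENNReal.ofReal (ρ ^ ((n : ℝ) + s)) * gagliardoIntegrand s q w x y) := by
        refine setLIntegral_mono' hS fun x hx => setLIntegral_mono' hA fun y hy => ?_
        exact abs_sub_le_gagliardoIntegrand hs0 hq w (hSA x hx y hy)
    _ = _ := by
        simp_rw [lintegral_add_left measurable_const,
          lintegral_const_mul' _ _ ENNReal.ofReal_ne_top]
        rw [Measure.volume_eq_prod, ← Measure.prod_restrict, lintegral_prod _ hGr]
        simp

theorem exists_finite_partition {n : ℕ} {Ω : Set (Rn n)} (hΩm : MeasurableSet Ω)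
    (hΩb : Bornology.IsBounded Ω) {ε : ℝ} (hε : 0 < ε) :
    ∃ (N : ℕ) (S : Fin N → Set (Rn n)) (c : Fin N → Rn n), (∀ i, MeasurableSet (S i)) ∧
      (∀ i, S i ⊆ Metric.ball (c i) ε) ∧ Pairwise (fun i j => Disjoint (S i) (S j)) ∧
      ⋃ i, S i = Ω := by
  obtain ⟨t, ht, hcov⟩ := Metric.totallyBounded_iff.1
    (hΩb.isCompact_closure.totallyBounded.subset subset_closure) ε hε
  obtain ⟨N, c, hc⟩ : ∃ (N : ℕ) (c : Fin N → Rn n), range c = t := by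
    have := ht.fintype
    refine ⟨Fintype.card t, fun i => ((Fintype.equivFin t).symm i : Rn n), ?_⟩
    ext y
    constructor
    · rintro ⟨i, rfl⟩
      exact Subtype.coe_prop _
    · intro hy
      exact ⟨Fintype.equivFin t ⟨y, hy⟩, by simp⟩
  refine ⟨N, fun i => Ω ∩ (Metric.ball (c i) ε \ ⋃ j : {j // j < i}, Metric.ball (c j) ε), c,
    fun i => ?_, fun i x hx => hx.2.1, fun i j hij => ?_, ?_⟩
  · exact hΩm.inter (measurableSet_ball.diff (MeasurableSet.iUnion fun j => measurableSet_ball))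
  · refine Set.disjoint_left.2 ?_
    rintro x ⟨_, h1, h2⟩ ⟨_, h3, h4⟩
    rcases lt_or_gt_of_ne hij with h | h
    · exact h4 (mem_iUnion.2 ⟨⟨i, h⟩, h1⟩)
    · exact h2 (mem_iUnion.2 ⟨⟨j, h⟩, h3⟩)
  · ext x
    constructor
    · intro hx
      obtain ⟨i, hi⟩ := mem_iUnion.1 hx
      exact hi.1
    · intro hx
      have hex : {i | x ∈ Metric.ball (c i) ε}.Nonempty := by
        obtain ⟨y, hy, hxy⟩ := mem_iUnion₂.1 (hcov hx)
        rw [← hc] at hy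
        obtain ⟨i, rfl⟩ := hy
        exact ⟨i, hxy⟩
      have hwf : WellFounded ((· < ·) : Fin N → Fin N → Prop) := wellFounded_lt
      -- Each point is assigned to the first ball containing it.
      refine mem_iUnion.2 ⟨hwf.min _ hex, hx, hwf.min_mem _ hex, ?_⟩
      rw [mem_iUnion]
      rintro ⟨⟨j, hj⟩, hjx⟩
      exact hwf.not_lt_min _ hjx hj

/-- `L¹` distance to a step function built from averages over balls. -/
theorem lintegral_sub_step_le {n : ℕ} {s q ε : ℝ} (hs0 : 0 < s) (hq : 1 ≤ q) (hε : 0 < ε)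
    {Ω : Set (Rn n)} {w : Rn n → ℝ} (hw : Integrable w) (hw0 : ∀ x ∉ Ω, w x = 0)
    {N : ℕ} {S : Fin N → Set (Rn n)} {c : Fin N → Rn n} (hS : ∀ i, MeasurableSet (S i))
    (hSc : ∀ i, S i ⊆ Metric.ball (c i) ε) (hdisj : Pairwise fun i j => Disjoint (S i) (S j))
    (hSΩ : ⋃ i, S i = Ω) :
    ∫⁻ x, ‖w x - ∑ i, (⨍ y in Metric.ball (c i) ε, w y) * (S i).indicator (fun _ => (1 : ℝ)) x‖ₑ ≤
      ENNReal.ofReal ((2 * ε) ^ s) * volume Ω +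
      (volume (Metric.ball (0 : Rn n) ε))⁻¹ * ENNReal.ofReal ((2 * ε) ^ ((n : ℝ) + s)) *
        ∫⁻ z in Ω ×ˢ univ, gagliardoIntegrand s q w z.1 z.2 := by
  set A : Fin N → Set (Rn n) := fun i => Metric.ball (c i) ε
  set V := volume (Metric.ball (0 : Rn n) ε)
  have hAV : ∀ i, volume (A i) = V := fun i => by
    simp only [A, V, Measure.addHaar_ball_center]
  have hV0 : V ≠ 0 := (Metric.measure_ball_pos _ _ hε).ne'
  have hVt : V ≠ ⊤ := measure_ball_lt_top.ne
  set m : Fin N → ℝ := fun i => ⨍ y in A i, w y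
  have hpt : ∀ x, ‖w x - ∑ i, m i * (S i).indicator (fun _ => (1 : ℝ)) x‖ₑ =
      ∑ i, (S i).indicator (fun x => ‖w x - m i‖ₑ) x := by
    intro x
    by_cases hx : x ∈ Ω
    · rw [← hSΩ] at hx
      obtain ⟨j, hj⟩ := mem_iUnion.1 hx
      have hne : ∀ i, i ≠ j → x ∉ S i := fun i hij hi =>
        Set.disjoint_left.1 (hdisj hij) hi hj
      rw [Finset.sum_eq_single j (fun i _ hij => by simp [hne i hij]) (by simp),
        Finset.sum_eq_single j (fun i _ hij => by simp [hne i hij]) (by simp)]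
      simp [hj]
    · have hne : ∀ i, x ∉ S i := fun i hi => hx (hSΩ ▸ mem_iUnion.2 ⟨i, hi⟩)
      simp [hne, hw0 x hx]
  -- Subtracting a mean is averaging the differences. The means are over full balls, all of the same
  -- volume `V`, while the pieces `S i` may be arbitrarily small.
  have hmean : ∀ i x, ‖w x - m i‖ₑ ≤ V⁻¹ * ∫⁻ y in A i, ENNReal.ofReal |w x - w y| := by
    intro i x
    have hAi : volume (A i) ≠ ⊤ := (hAV i).trans_ne hVt
    have e : w x - m i = ⨍ y in A i, (w x - w y) := by
      have : IsFiniteMeasure (volume.restrict (A i)) := ⟨by simpa using hAi.lt_top⟩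
      have : NeZero (volume.restrict (A i)) :=
        ⟨fun h => hV0 (by rw [← hAV i, ← Measure.restrict_apply_univ, h]; rfl)⟩
      simp only [m, average]
      rw [integral_sub]
      · have hne : volume.real (A i) ≠ 0 := by
          rw [Measure.real, hAV]; exact (ENNReal.toReal_pos hV0 hVt).ne'
        rw [integral_const]
        simp only [Measure.restrict_apply_univ, smul_eq_mul]
        rw [integral_smul_measure]
        simp only [ENNReal.toReal_inv, ← measureReal_def, smul_eq_mul,
          measureReal_ennreal_smul_apply, measureReal_restrict_apply_univ]
        rw [inv_mul_cancel₀ hne, one_mul]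
      · exact integrable_const _
      · exact hw.restrict.smul_measure (by simp [hAV, hV0])
    rw [e, setAverage_eq, enorm_smul, Real.enorm_of_nonneg (by positivity),
      ENNReal.ofReal_inv_of_pos (by
        rw [Measure.real, hAV]; exact ENNReal.toReal_pos hV0 hVt),
      Measure.real, hAV, ENNReal.ofReal_toReal hVt]
    gcongr
    refine (enorm_integral_le_lintegral_enorm _).trans (le_of_eq ?_)
    simp_rw [Real.enorm_eq_ofReal_abs]
  have hi : ∀ i, ∫⁻ x in S i, ‖w x - m i‖ₑ ≤ ENNReal.ofReal ((2 * ε) ^ s) * volume (S i) +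
      V⁻¹ * ENNReal.ofReal ((2 * ε) ^ ((n : ℝ) + s)) *
        ∫⁻ z in S i ×ˢ univ, gagliardoIntegrand s q w z.1 z.2 := by
    intro i
    calc _ ≤ ∫⁻ x in S i, V⁻¹ * ∫⁻ y in A i, ENNReal.ofReal |w x - w y| :=
          lintegral_mono fun x => hmean i x
      _ = V⁻¹ * ∫⁻ x in S i, ∫⁻ y in A i, ENNReal.ofReal |w x - w y| :=
          lintegral_const_mul' _ _ (ENNReal.inv_ne_top.2 hV0)
      _ ≤ V⁻¹ * (ENNReal.ofReal ((2 * ε) ^ s) * volume (A i) * volume (S i) +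
          ENNReal.ofReal ((2 * ε) ^ ((n : ℝ) + s)) *
          ∫⁻ z in S i ×ˢ univ, gagliardoIntegrand s q w z.1 z.2) := by
          gcongr
          refine (setLIntegral_abs_sub_le (q := q) (ρ := 2 * ε) hs0 hq hw.aemeasurable (hS i)
            measurableSet_ball fun x hx y hy => ?_).trans ?_
          · rw [← dist_eq_norm]
            have h1 : dist x (c i) < ε := hSc i hx
            have h2 : dist y (c i) < ε := hy
            have h3 := dist_triangle_right x y (c i)
            linarith
          · gcongr
            exact subset_univ _
      _ = (V⁻¹ * V) * ENNReal.ofReal ((2 * ε) ^ s) * volume (S i) +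
          V⁻¹ * ENNReal.ofReal ((2 * ε) ^ ((n : ℝ) + s)) *
          ∫⁻ z in S i ×ˢ univ, gagliardoIntegrand s q w z.1 z.2 := by
          rw [hAV]; ring
      _ = _ := by rw [ENNReal.inv_mul_cancel hV0 hVt, one_mul]
  calc _ = ∫⁻ x, ∑ i, (S i).indicator (fun x => ‖w x - m i‖ₑ) x := lintegral_congr hpt
    _ = ∑ i, ∫⁻ x in S i, ‖w x - m i‖ₑ := by
        rw [lintegral_finsetSum' _ fun i _ => AEMeasurable.indicator
          (hw.aemeasurable.sub_const _).enorm (hS i)]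
        simp_rw [lintegral_indicator (hS _)]
    _ ≤ ∑ i, (ENNReal.ofReal ((2 * ε) ^ s) * volume (S i) +
      V⁻¹ * ENNReal.ofReal ((2 * ε) ^ ((n : ℝ) + s)) *
        ∫⁻ z in S i ×ˢ univ, gagliardoIntegrand s q w z.1 z.2) := Finset.sum_le_sum fun i _ => hi i
    _ = _ := by
        rw [Finset.sum_add_distrib, ← Finset.mul_sum, ← Finset.mul_sum]
        congr 2
        · rw [← hSΩ, measure_iUnion hdisj hS, tsum_fintype]
        · rw [← hSΩ, iUnion_prod_const, lintegral_iUnion (fun i => (hS i).prod .univ)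
            (fun i j hij => (Set.disjoint_prod.2 (Or.inl (hdisj hij)))), tsum_fintype]

/-- A Poincaré inequality: on a unit ball `A` disjoint from `Ω` the function vanishes, so its
differences between `Ω` and `A` are its own values. All distances involved are at most `2 * R + 2`,
and the constants do not depend on `q`. -/
theorem lintegral_abs_le_of_gagliardo_le {n : ℕ} (hn : 1 ≤ n) {s : ℝ} (hs0 : 0 < s)
    {Ω : Set (Rn n)} (hΩm : MeasurableSet Ω) (hΩb : Bornology.IsBounded Ω) {C : ℝ≥0∞}
    (hC : C < ⊤) :
    ∃ B : ℝ≥0∞, B < ⊤ ∧ ∀ (q : ℝ) (w : Rn n → ℝ), 1 ≤ q → AEMeasurable w →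
      (∀ x ∉ Ω, w x = 0) → ∫⁻ z in Ω ×ˢ univ, gagliardoIntegrand s q w z.1 z.2 ≤ C →
      ∫⁻ x, ‖w x‖ₑ ≤ B := by
  have : Nonempty (Fin n) := ⟨⟨0, hn⟩⟩
  obtain ⟨R, hR0, hR⟩ := hΩb.subset_ball_lt 0 (0 : Rn n)
  obtain ⟨y₀, hy₀⟩ := exists_norm_eq (Rn n) (by positivity : 0 ≤ R + 1)
  set A := Metric.ball y₀ 1
  have hV0 : volume A ≠ 0 := (Metric.measure_ball_pos _ _ one_pos).ne'
  have hVt : volume A ≠ ⊤ := measure_ball_lt_top.ne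
  have hAΩ : ∀ y ∈ A, y ∉ Ω := by
    intro y hy hyΩ
    have h1 : ‖y‖ < R := by simpa using hR hyΩ
    have h2 : dist y y₀ < 1 := hy
    rw [dist_comm, dist_eq_norm] at h2
    have := norm_sub_norm_le y₀ y
    linarith
  set ρ := 2 * R + 2
  refine ⟨(volume A)⁻¹ * (ENNReal.ofReal (ρ ^ s) * volume A * volume Ω +
    ENNReal.ofReal (ρ ^ ((n : ℝ) + s)) * C), ?_, ?_⟩
  · refine ENNReal.mul_lt_top (ENNReal.inv_lt_top.2 hV0.bot_lt) (ENNReal.add_lt_top.2 ⟨?_, ?_⟩)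
    · exact ENNReal.mul_lt_top (ENNReal.mul_lt_top ENNReal.ofReal_lt_top hVt.lt_top)
        hΩb.measure_lt_top
    · exact ENNReal.mul_lt_top ENNReal.ofReal_lt_top hC
  · intro q w hq hw hw0 hwC
    have h1 := setLIntegral_abs_sub_le (q := q) (ρ := ρ) (S := Ω) (A := A) hs0 hq hw hΩm
      measurableSet_ball (fun x hx y hy => by
        have h1 : ‖x‖ < R := by simpa using hR hx
        have h2 : dist y y₀ < 1 := hy
        rw [dist_eq_norm] at h2
        have h3 := norm_sub_le x y
        have h4 := norm_sub_norm_le y y₀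
        simp only [ρ]
        linarith)
    have h2 : ∫⁻ x in Ω, ∫⁻ y in A, ENNReal.ofReal |w x - w y| = volume A * ∫⁻ x, ‖w x‖ₑ := by
      have : ∀ x, ∫⁻ y in A, ENNReal.ofReal |w x - w y| = volume A * ‖w x‖ₑ := by
        intro x
        rw [setLIntegral_congr_fun measurableSet_ball
          (g := fun _ => ‖w x‖ₑ) (fun y hy => by
            simp [hw0 y (hAΩ y hy), Real.enorm_eq_ofReal_abs]), setLIntegral_const, mul_comm]
      simp_rw [this]
      rw [lintegral_const_mul' _ _ hVt, setLIntegral_eq_of_support_subset]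
      intro x hx
      by_contra hxΩ
      exact hx (by simp [hw0 x hxΩ])
    rw [h2] at h1
    calc ∫⁻ x, ‖w x‖ₑ = (volume A)⁻¹ * (volume A * ∫⁻ x, ‖w x‖ₑ) := by
          rw [← mul_assoc, ENNReal.inv_mul_cancel hV0 hVt, one_mul]
      _ ≤ _ := by
          gcongr
          refine h1.trans ?_
          gcongr
          exact (lintegral_mono_set (prod_mono_right (subset_univ _))).trans hwC

theorem coeFn_sum_Lp {α ι : Type*} [MeasurableSpace α] {μ : Measure α} {q : ℝ≥0∞}
    (t : Finset ι) (F : ι → Lp ℝ q μ) :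
    ⇑(∑ i ∈ t, F i) =ᵐ[μ] fun x => ∑ i ∈ t, F i x := by
  classical
  induction t using Finset.induction_on with
  | empty => exact Lp.coeFn_zero ℝ q μ
  | insert a t ha ih =>
    rw [Finset.sum_insert ha]
    filter_upwards [Lp.coeFn_add (F a) (∑ i ∈ t, F i), ih] with x h1 h2
    rw [h1, Pi.add_apply, h2, Finset.sum_insert ha]

theorem totallyBounded_of_approx {X : Type*} [PseudoMetricSpace X] {s : Set X}
    (h : ∀ ε > 0, ∃ t : Set X, TotallyBounded t ∧ ∀ x ∈ s, ∃ y ∈ t, dist x y < ε) :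
    TotallyBounded s := by
  refine Metric.totallyBounded_iff.2 fun ε hε => ?_
  obtain ⟨t, ht, hst⟩ := h (ε / 2) (half_pos hε)
  obtain ⟨f, hf, htf⟩ := Metric.totallyBounded_iff.1 ht (ε / 2) (half_pos hε)
  refine ⟨f, hf, fun x hx => ?_⟩
  obtain ⟨y, hy, hxy⟩ := hst x hx
  obtain ⟨z, hz, hyz⟩ := mem_iUnion₂.1 (htf hy)
  refine mem_iUnion₂.2 ⟨z, hz, ?_⟩
  rw [Metric.mem_ball] at *
  linarith [dist_triangle x y z]

/-- The ball volume is proportional to `ε ^ n`, so both terms are multiples of `ε ^ s`. -/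
theorem exists_small_scale {n : ℕ} {s : ℝ} (hs0 : 0 < s) {V C : ℝ≥0∞} (hV : V < ⊤)
    (hC : C < ⊤) {η : ℝ} (hη : 0 < η) :
    ∃ ε : ℝ, 0 < ε ∧ ENNReal.ofReal ((2 * ε) ^ s) * V +
      (volume (Metric.ball (0 : Rn n) ε))⁻¹ * ENNReal.ofReal ((2 * ε) ^ ((n : ℝ) + s)) * C <
        ENNReal.ofReal η := by
  set ω := (volume (Metric.ball (0 : Rn n) 1)).toReal
  have hω : 0 < ω := ENNReal.toReal_pos (Metric.measure_ball_pos _ _ one_pos).ne'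
    measure_ball_lt_top.ne
  have key : ∀ ε : ℝ, 0 < ε → ENNReal.ofReal ((2 * ε) ^ s) * V +
      (volume (Metric.ball (0 : Rn n) ε))⁻¹ * ENNReal.ofReal ((2 * ε) ^ ((n : ℝ) + s)) * C =
      ENNReal.ofReal ((2 * ε) ^ s * (V.toReal + 2 ^ n / ω * C.toReal)) := by
    intro ε hε
    have hv : volume (Metric.ball (0 : Rn n) ε) = ENNReal.ofReal (ε ^ n * ω) := by
      rw [Measure.addHaar_ball_of_pos _ _ hε, finrank_euclideanSpace_fin,
        ENNReal.ofReal_mul (by positivity), ENNReal.ofReal_toReal measure_ball_lt_top.ne]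
    rw [hv, ← ENNReal.ofReal_inv_of_pos (by positivity), ← ENNReal.ofReal_toReal hV.ne,
      ← ENNReal.ofReal_toReal hC.ne, ← ENNReal.ofReal_mul (by positivity),
      ← ENNReal.ofReal_mul (by positivity), ← ENNReal.ofReal_mul (by positivity),
      ← ENNReal.ofReal_add (by positivity) (by positivity),
      ENNReal.toReal_ofReal ENNReal.toReal_nonneg, ENNReal.toReal_ofReal ENNReal.toReal_nonneg]
    congr 1
    rw [Real.rpow_add (by positivity), Real.rpow_natCast, mul_pow]
    field_simp
  have hlim : Tendsto (fun ε : ℝ => (2 * ε) ^ s * (V.toReal + 2 ^ n / ω * C.toReal))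
      (𝓝[>] 0) (𝓝 0) := by
    have h1 : Continuous fun ε : ℝ => (2 * ε) ^ s * (V.toReal + 2 ^ n / ω * C.toReal) :=
      ((continuous_const.mul continuous_id).rpow_const fun _ => Or.inr hs0.le).mul
        continuous_const
    have h2 := h1.tendsto 0
    rw [mul_zero, Real.zero_rpow hs0.ne', zero_mul] at h2
    exact h2.mono_left nhdsWithin_le_nhds
  obtain ⟨ε, hε, hε0⟩ := ((hlim.eventually (gt_mem_nhds hη)).and self_mem_nhdsWithin).exists
  refine ⟨ε, hε0, ?_⟩
  rw [key ε hε0]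
  exact (ENNReal.ofReal_lt_ofReal_iff hη).2 hε

/-- The sequence is totally bounded in `L¹`: at each accuracy it lies near step functions on a fixed
finite partition with bounded coefficients, a compact set. Completeness of `L¹` then gives a
convergent subsequence. -/
theorem exists_subseq_tendsto_L1 {n : ℕ} (hn : 1 ≤ n) {s : ℝ} (hs0 : 0 < s)
    {Ω : Set (Rn n)} (hΩm : MeasurableSet Ω) (hΩb : Bornology.IsBounded Ω)
    {p : ℕ → ℝ} (hp : ∀ k, 1 ≤ p k) {w : ℕ → Rn n → ℝ} (hw : ∀ k, Integrable (w k))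
    (hw0 : ∀ k, ∀ x ∉ Ω, w k x = 0) {C : ℝ≥0∞} (hC : C < ⊤)
    (hbd : ∀ k, ∫⁻ z in Ω ×ˢ univ, gagliardoIntegrand s (p k) (w k) z.1 z.2 ≤ C) :
    ∃ κ : ℕ → ℕ, StrictMono κ ∧ ∃ w' : Rn n → ℝ, Integrable w' ∧
      Tendsto (fun j => eLpNorm (fun x => w (κ j) x - w' x) 1 volume) atTop (𝓝 0) := by
  obtain ⟨B, hB, hBw⟩ := lintegral_abs_le_of_gagliardo_le hn hs0 hΩm hΩb hC
  have hL : ∀ k, MemLp (w k) 1 volume := fun k => memLp_one_iff_integrable.2 (hw k)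
  set W : ℕ → Lp ℝ 1 (volume : Measure (Rn n)) := fun k => (hL k).toLp
  have htb : TotallyBounded (range W) := by
    refine totallyBounded_of_approx fun η hη => ?_
    obtain ⟨ε, hε, hεη⟩ := exists_small_scale (n := n) hs0 (hΩb.measure_lt_top (μ := volume)) hC hη
    obtain ⟨N, S, c, hS, hSc, hdisj, hSΩ⟩ := exists_finite_partition hΩm hΩb hε
    have hSfin : ∀ i, volume (S i) ≠ ⊤ := fun i =>
      (Metric.isBounded_ball.subset (hSc i)).measure_lt_top.ne
    let Φ : (Fin N → ℝ) → Lp ℝ 1 (volume : Measure (Rn n)) := fun a =>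
      ∑ i, a i • indicatorConstLp 1 (hS i) (hSfin i) (1 : ℝ)
    have hΦ : Continuous Φ := by fun_prop
    have hΦae : ∀ a, ⇑(Φ a) =ᵐ[volume]
        fun x => ∑ i, a i * (S i).indicator (fun _ => (1 : ℝ)) x := by
      intro a
      have h1 := coeFn_sum_Lp Finset.univ
        (fun i => a i • indicatorConstLp 1 (hS i) (hSfin i) (1 : ℝ))
      have h2 : ∀ᵐ x ∂(volume : Measure (Rn n)), ∀ i,
          (a i • indicatorConstLp 1 (hS i) (hSfin i) (1 : ℝ) : Lp ℝ 1 volume) x =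
            a i * (S i).indicator (fun _ => (1 : ℝ)) x := by
        refine ae_all_iff.2 fun i => ?_
        filter_upwards [Lp.coeFn_smul (a i) (indicatorConstLp 1 (hS i) (hSfin i) (1 : ℝ)),
          indicatorConstLp_coeFn (p := 1) (hs := hS i) (hμs := hSfin i) (c := (1 : ℝ))]
          with x e1 e2
        rw [e1, Pi.smul_apply, e2, smul_eq_mul]
      filter_upwards [h1, h2] with x e1 e2
      rw [e1]
      exact Finset.sum_congr rfl fun i _ => e2 i
    set V := volume (Metric.ball (0 : Rn n) ε)
    -- The uniform `L¹` bound divided by the ball volume bounds every average, so the coefficients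
    -- stay in a compact cube.
    set b : ℝ := (V.toReal)⁻¹ * B.toReal
    refine ⟨Φ '' (Set.pi univ fun _ => Icc (-b) b),
      ((isCompact_univ_pi fun _ => isCompact_Icc).image hΦ).totallyBounded, ?_⟩
    rintro _ ⟨k, rfl⟩
    refine ⟨_, ⟨fun i => ⨍ y in Metric.ball (c i) ε, w k y, fun i _ => ?_, rfl⟩, ?_⟩
    · refine abs_le.1 ?_
      change |⨍ y in Metric.ball (c i) ε, w k y| ≤ b
      rw [← Real.norm_eq_abs, setAverage_eq, norm_smul, norm_inv,
        Real.norm_of_nonneg measureReal_nonneg, Measure.real, Measure.addHaar_ball_center]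
      refine mul_le_mul_of_nonneg_left ?_ (by positivity)
      refine (norm_integral_le_lintegral_norm _).trans ?_
      refine ENNReal.toReal_mono hB.ne ?_
      simp_rw [ofReal_norm]
      exact (setLIntegral_le_lintegral _ _).trans
        (hBw (p k) (w k) (hp k) (hw k).aemeasurable (hw0 k) (hbd k))
    · rw [← ENNReal.ofReal_lt_ofReal_iff hη, ← edist_dist, Lp.edist_def,
        eLpNorm_one_eq_lintegral_enorm]
      refine lt_of_le_of_lt ?_ hεη
      calc _ = ∫⁻ x, ‖w k x - ∑ i, (⨍ y in Metric.ball (c i) ε, w k y) *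
            (S i).indicator (fun _ => (1 : ℝ)) x‖ₑ := by
            refine lintegral_congr_ae ?_
            filter_upwards [(hL k).coeFn_toLp, hΦae fun i => ⨍ y in Metric.ball (c i) ε, w k y]
              with x e1 e2
            rw [Pi.sub_apply, e1, e2]
        _ ≤ _ := lintegral_sub_step_le (q := p k) hs0 (hp k) hε (hw k) (hw0 k) hS hSc hdisj hSΩ
        _ ≤ _ := by
            gcongr
            exact hbd k
  have hcomp : IsCompact (closure (range W)) :=
    isCompact_iff_totallyBounded_isComplete.2
      ⟨htb.closure, isClosed_closure.isComplete⟩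
  obtain ⟨w', -, κ, hκ, hlim⟩ :=
    hcomp.tendsto_subseq (x := W) fun k => subset_closure (mem_range_self k)
  refine ⟨κ, hκ, w', L1.integrable_coeFn w', ?_⟩
  have := tendsto_iff_edist_tendsto_0.1 hlim
  refine this.congr fun j => ?_
  rw [Lp.edist_def]
  refine eLpNorm_congr_ae ?_
  filter_upwards [(hL (κ j)).coeFn_toLp] with x e1
  simp only [Pi.sub_apply, Function.comp_apply, W, e1]

/-! ### Energies and competitors -/

theorem prod_self_subset_Q {n : ℕ} (Ω : Set (Rn n)) : Ω ×ˢ Ω ⊆ Q Ω :=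
  fun _ hz h => h.1 hz.1

theorem prod_univ_subset_Q {n : ℕ} (Ω : Set (Rn n)) : Ω ×ˢ univ ⊆ Q Ω :=
  fun _ hz h => h.1 hz.1

theorem energy_le_energy_iff {n : ℕ} (Ω : Set (Rn n)) (s : ℝ) {q : ℝ} (hq : 0 < q)
    (u v : Rn n → ℝ) : energy Ω s q u ≤ energy Ω s q v ↔
      ∫⁻ z in Q Ω, gagliardoIntegrand s q u z.1 z.2 ≤
        ∫⁻ z in Q Ω, gagliardoIntegrand s q v z.1 z.2 := by
  have h0 : ENNReal.ofReal (1 / (2 * q)) ≠ 0 := by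
    rw [Ne, ENNReal.ofReal_eq_zero, not_le]; positivity
  exact ENNReal.mul_le_mul_iff_right h0 ENNReal.ofReal_ne_top

theorem energy_lt_top_iff {n : ℕ} (Ω : Set (Rn n)) (s : ℝ) {q : ℝ} (hq : 0 < q)
    (u : Rn n → ℝ) : energy Ω s q u < ⊤ ↔
      ∫⁻ z in Q Ω, gagliardoIntegrand s q u z.1 z.2 < ⊤ := by
  have h0 : ENNReal.ofReal (1 / (2 * q)) ≠ 0 := by
    rw [Ne, ENNReal.ofReal_eq_zero, not_le]; positivity
  unfold energy
  constructor
  · intro h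
    by_contra hc
    rw [not_lt, top_le_iff] at hc
    rw [hc, ENNReal.mul_top h0] at h
    exact lt_irrefl _ h
  · exact ENNReal.mul_lt_top ENNReal.ofReal_lt_top

theorem mem_spaceW_of_lintegral_Q_lt_top {n : ℕ} {Ω : Set (Rn n)} {s q : ℝ} (hq : 0 < q)
    {u : Rn n → ℝ} (hu : AEMeasurable u)
    (hLp : MemLp u (ENNReal.ofReal q) (volume.restrict Ω))
    (hQ : ∫⁻ z in Q Ω, gagliardoIntegrand s q u z.1 z.2 < ⊤) : u ∈ spaceW Ω s q := by
  refine ⟨hu, hLp, ENNReal.rpow_lt_top_of_nonneg (by positivity) (ne_of_lt ?_)⟩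
  have h1 := (lintegral_mono_set (prod_self_subset_Q Ω)).trans_lt hQ
  rwa [Measure.volume_eq_prod, ← Measure.prod_restrict,
    lintegral_prod _ (aemeasurable_gagliardoIntegrand s q hu.restrict)] at h1

/-- `Q Ω` consists of `Ω ×ˢ Ω` and two cross blocks exchanged by the swap. -/
theorem setLIntegral_Q_le {n : ℕ} {Ω : Set (Rn n)} {f : Rn n × Rn n → ℝ≥0∞}
    (hsymm : ∀ z, f z.swap = f z) (h0 : ∀ z ∈ Ω ×ˢ Ω, f z = 0) (hΩ : MeasurableSet Ω) :
    ∫⁻ z in Q Ω, f z ≤ 2 * ∫⁻ z in Ω ×ˢ Ωᶜ, f z := by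
  have hsub : Q Ω ⊆ Ω ×ˢ Ω ∪ (Ω ×ˢ Ωᶜ ∪ Ωᶜ ×ˢ Ω) := by
    intro z hz
    simp only [Q, mem_compl_iff, mem_prod, mem_union] at hz ⊢
    tauto
  have hswap : ∫⁻ z in Ωᶜ ×ˢ Ω, f z = ∫⁻ z in Ω ×ˢ Ωᶜ, f z := by
    rw [Measure.volume_eq_prod, ← Measure.prod_restrict, ← Measure.prod_restrict,
      ← lintegral_prod_swap]
    simp_rw [hsymm]
  calc _ ≤ _ := lintegral_mono_set hsub
    _ ≤ (∫⁻ z in Ω ×ˢ Ω, f z) + ((∫⁻ z in Ω ×ˢ Ωᶜ, f z) + ∫⁻ z in Ωᶜ ×ˢ Ω, f z) :=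
        (lintegral_union_le _ _ _).trans (add_le_add_right (lintegral_union_le _ _ _) _)
    _ = _ := by
        rw [hswap, setLIntegral_congr_fun (hΩ.prod hΩ) (g := fun _ => 0) h0, lintegral_zero,
          zero_add, two_mul]

/-- For the competitor vanishing in `Ω` only the cross blocks contribute, and integrating the
exterior variable gives exactly the tail. -/
theorem lintegral_Q_indicator_compl_le {n : ℕ} {Ω : Set (Rn n)} (hΩ : MeasurableSet Ω) (s : ℝ)
    {q : ℝ} (hq : 0 < q) {u φ : Rn n → ℝ} (hu : AEMeasurable u)
    (huφ : ∀ᵐ x ∂(volume.restrict Ωᶜ), u x = φ x) :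
    ∫⁻ z in Q Ω, gagliardoIntegrand s q (Ωᶜ.indicator u) z.1 z.2 ≤
      2 * ∫⁻ x in Ω, tail Ω s q φ x := by
  refine (setLIntegral_Q_le (fun z => gagliardoIntegrand_comm s q _ _ _) ?_ hΩ).trans ?_
  · rintro ⟨x, y⟩ ⟨hx, hy⟩
    simp only at hx hy
    simp [gagliardoIntegrand, hx, hy, Real.zero_rpow hq.ne']
  · have hG := aemeasurable_gagliardoIntegrand s q (hu.indicator hΩ.compl)
    have hGr : AEMeasurable
        (fun z : Rn n × Rn n => gagliardoIntegrand s q (Ωᶜ.indicator u) z.1 z.2)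
        ((volume.restrict Ω).prod (volume.restrict Ωᶜ)) := by
      rw [Measure.prod_restrict]; exact hG.restrict
    rw [Measure.volume_eq_prod, ← Measure.prod_restrict, lintegral_prod _ hGr]
    gcongr 2 * ?_
    refine setLIntegral_mono' hΩ fun x hx => le_of_eq ?_
    refine lintegral_congr_ae ?_
    filter_upwards [huφ, ae_restrict_mem hΩ.compl] with y hy hyΩ
    simp [gagliardoIntegrand, hx, indicator_of_mem hyΩ, hy]

theorem IsMinimizer.lintegral_Q_le {n : ℕ} {Ω : Set (Rn n)} (hΩ : MeasurableSet Ω) {s q : ℝ}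
    (hq : 0 < q) {u : Rn n → ℝ} (hu : IsMinimizer Ω s q u) :
    ∫⁻ z in Q Ω, gagliardoIntegrand s q u z.1 z.2 ≤
      ∫⁻ z in Q Ω, gagliardoIntegrand s q (Ωᶜ.indicator u) z.1 z.2 := by
  rw [← energy_le_energy_iff Ω s hq]
  refine hu.2.2 _ ⟨hu.1.1.indicator hΩ.compl, ?_, ?_⟩ ?_
  · refine (MemLp.zero' (ε := ℝ)).ae_eq ?_
    filter_upwards [ae_restrict_mem hΩ] with x hx
    simp [hx]
  · have : ∫⁻ x in Ω, ∫⁻ y in Ω, gagliardoIntegrand s q (Ωᶜ.indicator u) x y = 0 := by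
      rw [setLIntegral_congr_fun hΩ (g := fun _ => 0), lintegral_zero]
      intro x hx
      simp only
      rw [setLIntegral_congr_fun hΩ (g := fun _ => 0), lintegral_zero]
      intro y hy
      simp [gagliardoIntegrand, hx, hy, Real.zero_rpow hq.ne']
    rw [gagliardoSeminorm, this, ENNReal.zero_rpow_of_pos (by positivity)]
    exact ENNReal.zero_lt_top
  · filter_upwards [ae_restrict_mem hΩ.compl] with x hx
    simp [indicator_of_mem hx]

theorem ae_restrict_Q_of_ae {n : ℕ} {Ω : Set (Rn n)} {r : Rn n → Prop} (h : ∀ᵐ x, r x) :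
    ∀ᵐ z ∂(volume.restrict (Q Ω)), r z.1 ∧ r z.2 := by
  have h1 := Measure.quasiMeasurePreserving_fst (μ := (volume : Measure (Rn n)))
    (ν := (volume : Measure (Rn n))) |>.ae h
  have h2 := Measure.quasiMeasurePreserving_snd (μ := (volume : Measure (Rn n)))
    (ν := (volume : Measure (Rn n))) |>.ae h
  refine ae_restrict_of_ae ?_
  rw [Measure.volume_eq_prod]
  filter_upwards [h1, h2] with z e1 e2 using ⟨e1, e2⟩

theorem lintegral_Q_lipschitz_lt_top {n : ℕ} (hn : 1 ≤ n) {s : ℝ} (hs0 : 0 < s) (hs1 : s < 1)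
    {Ω : Set (Rn n)} (hΩ : volume Ω < ⊤) {q M : ℝ} (hq : 1 ≤ q) (hM : 1 ≤ M) {ψ : Rn n → ℝ}
    (hψ : ∀ x y, |ψ x - ψ y| ≤ M * min 1 ‖x - y‖) :
    ∫⁻ z in Q Ω, gagliardoIntegrand s q ψ z.1 z.2 < ⊤ := by
  calc _ ≤ ∫⁻ z in Q Ω, ENNReal.ofReal (M ^ q) *
        ENNReal.ofReal (truncKernel n s 1 (z.1 - z.2)) :=
        lintegral_mono fun z =>
          gagliardoIntegrand_le_truncKernel hs0 hs1 hq le_rfl hM (hψ z.1 z.2)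
    _ = ENNReal.ofReal (M ^ q) *
        ∫⁻ z in Q Ω, ENNReal.ofReal (truncKernel n s 1 (z.1 - z.2)) :=
        lintegral_const_mul' _ _ ENNReal.ofReal_ne_top
    _ < ⊤ := ENNReal.mul_lt_top ENNReal.ofReal_lt_top
        (setLIntegral_Q_truncKernel_lt_top hn hs0 hs1 hΩ)

theorem lintegral_Q_add_le {n : ℕ} {Ω : Set (Rn n)} (s : ℝ) {q : ℝ} (hq : 1 ≤ q)
    {u : Rn n → ℝ} (hu : AEMeasurable u) (v : Rn n → ℝ) :
    ∫⁻ z in Q Ω, gagliardoIntegrand s q (u + v) z.1 z.2 ≤ ENNReal.ofReal (2 ^ (q - 1)) *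
      ((∫⁻ z in Q Ω, gagliardoIntegrand s q u z.1 z.2) +
        ∫⁻ z in Q Ω, gagliardoIntegrand s q v z.1 z.2) := by
  rw [← lintegral_add_left' (aemeasurable_gagliardoIntegrand_volume s q hu).restrict,
    ← lintegral_const_mul' _ _ ENNReal.ofReal_ne_top]
  exact lintegral_mono fun z => gagliardoIntegrand_add_le s hq u v z.1 z.2

/-- Adding a Lipschitz function vanishing outside `Ω` gives an admissible competitor. -/
theorem IsMinimizer.lintegral_Q_le_add_lipschitz {n : ℕ} (hn : 1 ≤ n) {s : ℝ} (hs0 : 0 < s)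
    (hs1 : s < 1) {Ω : Set (Rn n)} (hΩm : MeasurableSet Ω) (hΩ : volume Ω < ⊤) {q M : ℝ}
    (hq : 1 ≤ q) (hM : 1 ≤ M) {ψ : Rn n → ℝ} (hψm : Measurable ψ)
    (hψ : ∀ x y, |ψ x - ψ y| ≤ M * min 1 ‖x - y‖) (hψb : ∀ x, |ψ x| ≤ M)
    (hψ0 : ∀ x ∉ Ω, ψ x = 0) {u : Rn n → ℝ} (hu : IsMinimizer Ω s q u) :
    ∫⁻ z in Q Ω, gagliardoIntegrand s q u z.1 z.2 ≤
      ∫⁻ z in Q Ω, gagliardoIntegrand s q (u + ψ) z.1 z.2 := by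
  have hq0 : 0 < q := by linarith
  have : IsFiniteMeasure (volume.restrict Ω) := ⟨by simpa using hΩ⟩
  rw [← energy_le_energy_iff Ω s hq0]
  refine hu.2.2 _ (mem_spaceW_of_lintegral_Q_lt_top hq0 (hu.1.1.add hψm.aemeasurable) ?_ ?_) ?_
  · exact hu.1.2.1.add (MemLp.of_bound hψm.aestronglyMeasurable M (.of_forall hψb))
  · refine (lintegral_Q_add_le s hq hu.1.1 ψ).trans_lt (ENNReal.mul_lt_top ENNReal.ofReal_lt_top
      (ENNReal.add_lt_top.2 ⟨?_, lintegral_Q_lipschitz_lt_top hn hs0 hs1 hΩ hq hM hψ⟩))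
    exact (energy_lt_top_iff Ω s hq0 u).1 hu.2.1
  · filter_upwards [ae_restrict_mem hΩm.compl] with x hx
    simp [hψ0 x hx]

/-! ### Passage to the limit -/

theorem lintegral_Q_le_of_tendsto {n : ℕ} {Ω : Set (Rn n)} (s : ℝ) {p : ℕ → ℝ}
    (hp1 : ∀ k, 1 < p k) (hp : Tendsto p atTop (𝓝 1)) {u : ℕ → Rn n → ℝ} {u₁ : Rn n → ℝ}
    (hu : ∀ k, AEMeasurable (u k)) (hlim : ∀ᵐ x, Tendsto (fun k => u k x) atTop (𝓝 (u₁ x)))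
    {C : ℝ≥0∞} (hC : ∀ k, ∫⁻ z in Q Ω, gagliardoIntegrand s (p k) (u k) z.1 z.2 ≤ C) :
    ∫⁻ z in Q Ω, gagliardoIntegrand s 1 u₁ z.1 z.2 ≤ C := by
  calc ∫⁻ z in Q Ω, gagliardoIntegrand s 1 u₁ z.1 z.2
      = ∫⁻ z in Q Ω, liminf (fun k => gagliardoIntegrand s (p k) (u k) z.1 z.2) atTop := by
        refine lintegral_congr_ae ?_
        filter_upwards [ae_restrict_Q_of_ae hlim] with z hz
        exact (tendsto_gagliardoIntegrand s one_pos hp (fun k => one_pos.trans (hp1 k))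
          hz.1 hz.2).liminf_eq.symm
    _ ≤ liminf (fun k => ∫⁻ z in Q Ω, gagliardoIntegrand s (p k) (u k) z.1 z.2) atTop :=
        lintegral_liminf_le' fun k => (aemeasurable_gagliardoIntegrand_volume s _ (hu k)).restrict
    _ ≤ C := liminf_le_of_frequently_le' (.of_forall hC)

theorem tendsto_lintegral_Q_lipschitz {n : ℕ} (hn : 1 ≤ n) {s : ℝ} (hs0 : 0 < s) (hs1 : s < 1)
    {Ω : Set (Rn n)} (hΩ : volume Ω < ⊤) {p : ℕ → ℝ} {P : ℝ} (hp1 : ∀ k, 1 < p k)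
    (hpP : ∀ k, p k ≤ P) (hp : Tendsto p atTop (𝓝 1)) {M : ℝ} (hM : 1 ≤ M) {ψ : Rn n → ℝ}
    (hψm : Measurable ψ) (hψ : ∀ x y, |ψ x - ψ y| ≤ M * min 1 ‖x - y‖) :
    Tendsto (fun k => ∫⁻ z in Q Ω, gagliardoIntegrand s (p k) ψ z.1 z.2) atTop
      (𝓝 (∫⁻ z in Q Ω, gagliardoIntegrand s 1 ψ z.1 z.2)) := by
  refine tendsto_lintegral_of_dominated_convergence' (fun z : Rn n × Rn n =>
    ENNReal.ofReal (M ^ P) * ENNReal.ofReal (truncKernel n s 1 (z.1 - z.2)))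
    (fun k => (aemeasurable_gagliardoIntegrand_volume s _ hψm.aemeasurable).restrict)
    (fun k => .of_forall fun z => gagliardoIntegrand_le_truncKernel hs0 hs1 (hp1 k).le (hpP k) hM
      (hψ z.1 z.2)) ?_ (.of_forall fun z => ?_)
  · rw [lintegral_const_mul' _ _ ENNReal.ofReal_ne_top]
    exact (ENNReal.mul_lt_top ENNReal.ofReal_lt_top
      (setLIntegral_Q_truncKernel_lt_top hn hs0 hs1 hΩ)).ne
  · exact tendsto_gagliardoIntegrand s one_pos hp (fun k => one_pos.trans (hp1 k))
      tendsto_const_nhds tendsto_const_nhds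

/-- Minimality against a fixed perturbation passes to the limit `p → 1`. -/
theorem lintegral_Q_le_add_of_tendsto {n : ℕ} {Ω : Set (Rn n)} (s : ℝ)
    {p : ℕ → ℝ} (hp1 : ∀ k, 1 < p k) (hp : Tendsto p atTop (𝓝 1)) {u : ℕ → Rn n → ℝ}
    {u₁ ψ : Rn n → ℝ} (hu : ∀ k, AEMeasurable (u k)) (hu₁ : AEMeasurable u₁)
    (hlim : ∀ᵐ x, Tendsto (fun k => u k x) atTop (𝓝 (u₁ x)))
    {C : ℝ≥0∞} (hCt : C < ⊤)
    (hC : ∀ k, ∫⁻ z in Q Ω, gagliardoIntegrand s (p k) (u k) z.1 z.2 ≤ C)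
    (hψm : AEMeasurable ψ)
    (hψfin : ∫⁻ z in Q Ω, gagliardoIntegrand s 1 ψ z.1 z.2 < ⊤)
    (hψlim : Tendsto (fun k => ∫⁻ z in Q Ω, gagliardoIntegrand s (p k) ψ z.1 z.2) atTop
      (𝓝 (∫⁻ z in Q Ω, gagliardoIntegrand s 1 ψ z.1 z.2)))
    (hmin : ∀ k, ∫⁻ z in Q Ω, gagliardoIntegrand s (p k) (u k) z.1 z.2 ≤
      ∫⁻ z in Q Ω, gagliardoIntegrand s (p k) (u k + ψ) z.1 z.2) :
    ∫⁻ z in Q Ω, gagliardoIntegrand s 1 u₁ z.1 z.2 ≤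
      ∫⁻ z in Q Ω, gagliardoIntegrand s 1 (u₁ + ψ) z.1 z.2 := by
  set G : ℝ → (Rn n → ℝ) → Rn n × Rn n → ℝ≥0∞ := fun q v z => gagliardoIntegrand s q v z.1 z.2
  have hGm : ∀ q {v}, AEMeasurable v → AEMeasurable (G q v) (volume.restrict (Q Ω)) :=
    fun q v hv => (aemeasurable_gagliardoIntegrand_volume s q hv).restrict
  have hGt : ∀ q v z, G q v z ≠ ⊤ := fun q v z => gagliardoIntegrand_ne_top s q v z.1 z.2
  set c : ℝ → ℝ≥0∞ := fun q => ENNReal.ofReal (2 ^ (q - 1))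
  have hct : ∀ q, c q ≠ ⊤ := fun q => ENNReal.ofReal_ne_top
  have hc1 : c 1 = 1 := by simp [c]
  have hclim : Tendsto (fun k => c (p k)) atTop (𝓝 1) := by
    have h1 : Tendsto (fun k => (2 : ℝ) ^ (p k - 1)) atTop (𝓝 (2 ^ ((1 : ℝ) - 1))) :=
      tendsto_const_nhds.rpow (hp.sub_const 1) (Or.inl two_ne_zero)
    have h2 := (ENNReal.continuous_ofReal.tendsto _).comp h1
    rwa [sub_self, Real.rpow_zero, ENNReal.ofReal_one] at h2
  have hcge : ∀ k, 1 ≤ c (p k) := by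
    intro k
    rw [← ENNReal.ofReal_one]
    exact ENNReal.ofReal_le_ofReal
      (Real.one_le_rpow one_le_two (by linarith [hp1 k]))
  -- The convexity defect. The subtraction is not truncated, by `gagliardoIntegrand_add_le`, which
  -- is what makes the identity `hgadd` hold.
  set g : ℝ → (Rn n → ℝ) → Rn n × Rn n → ℝ≥0∞ := fun q v z =>
    c q * (G q ψ z + G q v z) - G q (v + ψ) z
  have hgadd : ∀ q v, 1 ≤ q → AEMeasurable v →
      (∫⁻ z in Q Ω, g q v z) + ∫⁻ z in Q Ω, G q (v + ψ) z =
      c q * ((∫⁻ z in Q Ω, G q ψ z) + ∫⁻ z in Q Ω, G q v z) := by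
    intro q v hq hv
    rw [← lintegral_add_right' _ (hGm q (hv.add hψm)), ← lintegral_add_left' (hGm q hψm),
      ← lintegral_const_mul' _ _ (hct q)]
    refine lintegral_congr fun z => tsub_add_cancel_of_le ?_
    rw [add_comm (G q ψ z)]
    exact gagliardoIntegrand_add_le s hq v ψ z.1 z.2
  have hgm : ∀ k, AEMeasurable (g (p k) (u k)) (volume.restrict (Q Ω)) := fun k =>
    (((hGm _ hψm).add (hGm _ (hu k))).const_mul _).sub (hGm _ ((hu k).add hψm))
  -- By minimality the energy of `u k + ψ` in `hgadd` may be replaced by the smaller energy of `u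
  -- k`, which is finite and cancels up to the vanishing factor `c (p k) - 1`.
  have hgle : ∀ k, ∫⁻ z in Q Ω, g (p k) (u k) z ≤
      c (p k) * (∫⁻ z in Q Ω, G (p k) ψ z) + (c (p k) - 1) * C := by
    intro k
    have hA : ∫⁻ z in Q Ω, G (p k) (u k) z ≠ ⊤ := ((hC k).trans_lt hCt).ne
    have h1 := hgadd (p k) (u k) (hp1 k).le (hu k)
    have h2 : (∫⁻ z in Q Ω, g (p k) (u k) z) + ∫⁻ z in Q Ω, G (p k) (u k) z ≤
        (c (p k) * (∫⁻ z in Q Ω, G (p k) ψ z) + (c (p k) - 1) * C) +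
          ∫⁻ z in Q Ω, G (p k) (u k) z := by
      calc _ ≤ (∫⁻ z in Q Ω, g (p k) (u k) z) + ∫⁻ z in Q Ω, G (p k) (u k + ψ) z := by
            gcongr 1
            exact hmin k
        _ = c (p k) * (∫⁻ z in Q Ω, G (p k) ψ z) +
            ((c (p k) - 1) + 1) * ∫⁻ z in Q Ω, G (p k) (u k) z := by
            rw [h1, mul_add, tsub_add_cancel_of_le (hcge k)]
        _ = c (p k) * (∫⁻ z in Q Ω, G (p k) ψ z) +
            (c (p k) - 1) * (∫⁻ z in Q Ω, G (p k) (u k) z) + ∫⁻ z in Q Ω, G (p k) (u k) z := by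
            rw [add_mul, one_mul, add_assoc]
        _ ≤ _ := by
            gcongr
            exact hC k
    exact (ENNReal.add_le_add_iff_right hA).1 h2
  have hrhs : Tendsto (fun k => c (p k) * (∫⁻ z in Q Ω, G (p k) ψ z) + (c (p k) - 1) * C) atTop
      (𝓝 (∫⁻ z in Q Ω, G 1 ψ z)) := by
    have h1 := ENNReal.Tendsto.mul hclim (Or.inl one_ne_zero) hψlim (Or.inr ENNReal.one_ne_top)
    have h2 : Tendsto (fun k => c (p k) - 1) atTop (𝓝 (1 - 1)) :=
      ENNReal.Tendsto.sub hclim tendsto_const_nhds (Or.inl ENNReal.one_ne_top)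
    have h3 := ENNReal.Tendsto.mul_const (b := C) h2 (Or.inr hCt.ne)
    have h4 := h1.add h3
    simpa using h4
  have hfatou : ∫⁻ z in Q Ω, g 1 u₁ z ≤ ∫⁻ z in Q Ω, G 1 ψ z := by
    calc ∫⁻ z in Q Ω, g 1 u₁ z = ∫⁻ z in Q Ω, liminf (fun k => g (p k) (u k) z) atTop := by
          refine lintegral_congr_ae ?_
          filter_upwards [ae_restrict_Q_of_ae hlim] with z hz
          have hpos : ∀ k, 0 < p k := fun k => one_pos.trans (hp1 k)
          have t1 : Tendsto (fun k => G (p k) ψ z) atTop (𝓝 (G 1 ψ z)) :=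
            tendsto_gagliardoIntegrand s one_pos hp hpos tendsto_const_nhds tendsto_const_nhds
          have t2 : Tendsto (fun k => G (p k) (u k) z) atTop (𝓝 (G 1 u₁ z)) :=
            tendsto_gagliardoIntegrand s one_pos hp hpos hz.1 hz.2
          have t3 : Tendsto (fun k => G (p k) (u k + ψ) z) atTop (𝓝 (G 1 (u₁ + ψ) z)) :=
            tendsto_gagliardoIntegrand s one_pos hp hpos (hz.1.add_const _) (hz.2.add_const _)
          have t4 : Tendsto (fun k => g (p k) (u k) z) atTop (𝓝 (g 1 u₁ z)) := by
            refine ENNReal.Tendsto.sub ?_ t3 (Or.inr (hGt _ _ _))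
            rw [hc1]
            exact ENNReal.Tendsto.mul hclim (Or.inl one_ne_zero) (t1.add t2)
              (Or.inr ENNReal.one_ne_top)
          exact t4.liminf_eq.symm
      _ ≤ liminf (fun k => ∫⁻ z in Q Ω, g (p k) (u k) z) atTop := lintegral_liminf_le' hgm
      _ ≤ liminf (fun k => c (p k) * (∫⁻ z in Q Ω, G (p k) ψ z) + (c (p k) - 1) * C) atTop :=
          liminf_le_liminf (.of_forall hgle)
      _ = _ := hrhs.liminf_eq
  have h1 := hgadd 1 u₁ le_rfl hu₁
  rw [hc1, one_mul] at h1
  have h2 : (∫⁻ z in Q Ω, G 1 ψ z) + ∫⁻ z in Q Ω, G 1 u₁ z ≤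
      (∫⁻ z in Q Ω, G 1 ψ z) + ∫⁻ z in Q Ω, G 1 (u₁ + ψ) z := by
    rw [← h1]
    gcongr
  exact (ENNReal.add_le_add_iff_left hψfin.ne).1 h2

/-- The tail of the limit of the exterior data is controlled by the tails. -/
theorem tail_le_iSup_of_tendsto {n : ℕ} {Ω : Set (Rn n)} (hΩm : MeasurableSet Ω) (s : ℝ)
    {p : ℕ → ℝ} (hp : Tendsto p atTop (𝓝 1)) {φk : ℕ → Rn n → ℝ} {φ : Rn n → ℝ}
    (hm : ∀ k, AEMeasurable (φk k) (volume.restrict Ωᶜ))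
    (hφ : ∀ᵐ x ∂(volume.restrict Ωᶜ), Tendsto (fun k => φk k x) atTop (𝓝 (φ x)))
    {x : Rn n} (hx : x ∈ Ω) : tail Ω s 1 φ x ≤ ⨆ k, tail Ω s (p k) (φk k) x := by
  unfold tail
  calc _ = ∫⁻ y in Ωᶜ, liminf (fun k => ENNReal.ofReal
        (|φk k y| ^ p k / ‖x - y‖ ^ ((n : ℝ) + s * p k))) atTop := by
        refine lintegral_congr_ae ?_
        filter_upwards [hφ, ae_restrict_mem hΩm.compl] with y hy hyΩ
        have hpos : 0 < ‖x - y‖ := by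
          rw [norm_pos_iff, sub_ne_zero]
          rintro rfl
          exact hyΩ hx
        refine (Tendsto.liminf_eq ((ENNReal.continuous_ofReal.tendsto _).comp
          (Tendsto.div ?_ ?_ ?_))).symm
        · exact hy.abs.rpow hp (Or.inr one_pos)
        · exact tendsto_const_nhds.rpow (tendsto_const_nhds.add (tendsto_const_nhds.mul hp))
            (Or.inl hpos.ne')
        · positivity
    _ ≤ liminf (fun k => ∫⁻ y in Ωᶜ, ENNReal.ofReal
        (|φk k y| ^ p k / ‖x - y‖ ^ ((n : ℝ) + s * p k))) atTop := by
        refine lintegral_liminf_le' fun k => AEMeasurable.ennreal_ofReal ?_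
        refine AEMeasurable.div ((hm k).norm.pow_const _) (Measurable.aemeasurable ?_)
        fun_prop
    _ ≤ _ := liminf_le_of_frequently_le' (.of_forall fun k => le_iSup (fun k => ∫⁻ y in Ωᶜ,
        ENNReal.ofReal (|φk k y| ^ p k / ‖x - y‖ ^ ((n : ℝ) + s * p k))) k)

theorem aemeasurable_tail {n : ℕ} {Ω : Set (Rn n)} (s q : ℝ) {φ : Rn n → ℝ}
    (hφ : AEMeasurable φ (volume.restrict Ωᶜ)) :
    AEMeasurable (tail Ω s q φ) (volume.restrict Ω) := by
  unfold tail
  have h : AEMeasurable (fun z : Rn n × Rn n =>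
      ENNReal.ofReal (|φ z.2| ^ q / ‖z.1 - z.2‖ ^ ((n : ℝ) + s * q)))
      ((volume.restrict Ω).prod (volume.restrict Ωᶜ)) := by
    refine AEMeasurable.ennreal_ofReal (AEMeasurable.div ?_ (Measurable.aemeasurable ?_))
    · exact hφ.comp_snd.norm.pow_const q
    · fun_prop
  exact h.lintegral_prod_right'

/-- Minimality against Lipschitz perturbations vanishing outside `Ω` implies minimality. -/
theorem isMinimizer_one_of_lipschitz {n : ℕ} (hn : 1 ≤ n) {s : ℝ} (hs0 : 0 < s) (hs1 : s < 1)
    {Ω : Set (Rn n)} (hΩo : IsOpen Ω) (hΩb : Bornology.IsBounded Ω)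
    (hΩL : HasLipschitzBoundary Ω) (hne : Ωᶜ.Nonempty) {u : Rn n → ℝ} (hu : u ∈ spaceW Ω s 1)
    (hfin : ∫⁻ z in Q Ω, gagliardoIntegrand s 1 u z.1 z.2 < ⊤)
    (hmin : ∀ (ψ : Rn n → ℝ) (M : ℝ), 1 ≤ M → (∀ x y, |ψ x - ψ y| ≤ M * min 1 ‖x - y‖) →
      (∀ x, |ψ x| ≤ M) → (∀ x ∉ Ω, ψ x = 0) →
      ∫⁻ z in Q Ω, gagliardoIntegrand s 1 u z.1 z.2 ≤
        ∫⁻ z in Q Ω, gagliardoIntegrand s 1 (u + ψ) z.1 z.2) :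
    IsMinimizer Ω s 1 u := by
  have hΩm := hΩo.measurableSet
  refine ⟨hu, (energy_lt_top_iff Ω s one_pos u).2 hfin, fun v hv hvu => ?_⟩
  by_cases hvfin : energy Ω s 1 v < ⊤
  swap
  · rw [not_lt, top_le_iff] at hvfin
    rw [hvfin]
    exact le_top
  rw [energy_lt_top_iff Ω s one_pos] at hvfin
  rw [energy_le_energy_iff Ω s one_pos]
  have hd : AEMeasurable (v - u) := hv.1.sub hu.1
  -- A Borel representative of `v - u` that vanishes everywhere, not just almost everywhere, outside
  -- `Ω`.
  set ψ : Rn n → ℝ := Ω.indicator (hd.mk _)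
  have hψm : Measurable ψ := hd.measurable_mk.indicator hΩm
  have hψ0 : ∀ x ∉ Ω, ψ x = 0 := fun x hx => indicator_of_notMem hx _
  have hψae : ψ =ᵐ[volume] v - u := by
    filter_upwards [hd.ae_eq_mk, (ae_restrict_iff' hΩm.compl).1 hvu] with x h1 h2
    by_cases hx : x ∈ Ω
    · simp only [ψ, indicator_of_mem hx, h1]
    · simp [hψ0 x hx, h2 hx]
  have hint : Integrable ψ := by
    rw [integrable_indicator_iff hΩm]
    have h1 : Integrable (v - u) (volume.restrict Ω) := by
      have h2 := hv.2.1.sub hu.2.1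
      rwa [ENNReal.ofReal_one, memLp_one_iff_integrable] at h2
    exact h1.congr (ae_restrict_of_ae hd.ae_eq_mk)
  have hQψ : ∫⁻ z in Q Ω, gagliardoIntegrand s 1 ψ z.1 z.2 < ⊤ := by
    have h1 : ∫⁻ z in Q Ω, gagliardoIntegrand s 1 ψ z.1 z.2 =
        ∫⁻ z in Q Ω, gagliardoIntegrand s 1 (v + -u) z.1 z.2 := by
      rw [← sub_eq_add_neg]
      exact lintegral_congr_ae (ae_restrict_of_ae (gagliardoIntegrand_congr_ae s 1 hψae))
    have h2 : ∫⁻ z in Q Ω, gagliardoIntegrand s 1 (-u) z.1 z.2 =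
        ∫⁻ z in Q Ω, gagliardoIntegrand s 1 u z.1 z.2 := by
      refine lintegral_congr fun z => ?_
      simp only [gagliardoIntegrand, Pi.neg_apply, neg_sub_neg, abs_sub_comm (u z.2)]
    rw [h1]
    refine (lintegral_gagliardoIntegrand_add_le s
      (aemeasurable_gagliardoIntegrand_volume s 1 hv.1).restrict _).trans_lt ?_
    rw [h2]
    exact ENNReal.add_lt_top.2 ⟨hvfin, hfin⟩
  -- Pairs outside `Q Ω` have both points in the complement and contribute nothing, so the energy on
  -- `Q Ω` is the full seminorm.
  have hψfin : ∫⁻ z : Rn n × Rn n, gagliardoIntegrand s 1 ψ z.1 z.2 < ⊤ := by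
    rwa [setLIntegral_eq_of_support_subset] at hQψ
    intro z hz
    by_contra hzQ
    rw [Q, mem_compl_iff, not_not] at hzQ
    refine hz ?_
    simp [gagliardoIntegrand, hψ0 _ hzQ.1, hψ0 _ hzQ.2]
  refine ENNReal.le_of_forall_pos_le_add fun ε hε _ => ?_
  obtain ⟨ψ', M, hM, hlip, hbd, hψ'0, happ⟩ := exists_lipschitz_approx hn hs0 hs1 hΩo hΩb hΩL hne
    hψm hint hψ0 hψfin (ENNReal.coe_pos.2 hε)
  -- The Lipschitz perturbation of `u` differs from `v` only by the approximation error, whose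
  -- energy is at most `ε`.
  have hae : u + ψ' =ᵐ[volume] v + fun x => ψ' x - ψ x := by
    filter_upwards [hψae] with x hx
    simp only [Pi.add_apply, hx, Pi.sub_apply]
    ring
  calc _ ≤ ∫⁻ z in Q Ω, gagliardoIntegrand s 1 (u + ψ') z.1 z.2 := hmin ψ' M hM hlip hbd hψ'0
    _ = ∫⁻ z in Q Ω, gagliardoIntegrand s 1 (v + fun x => ψ' x - ψ x) z.1 z.2 :=
        lintegral_congr_ae (ae_restrict_of_ae (gagliardoIntegrand_congr_ae s 1 hae))
    _ ≤ _ := lintegral_gagliardoIntegrand_add_le s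
        (aemeasurable_gagliardoIntegrand_volume s 1 hv.1).restrict _
    _ ≤ _ := by
        gcongr
        exact (setLIntegral_le_lintegral _ _).trans happ

theorem nonempty_compl_of_isBounded {n : ℕ} (hn : 1 ≤ n) {Ω : Set (Rn n)}
    (hΩb : Bornology.IsBounded Ω) : Ωᶜ.Nonempty := by
  have : Nonempty (Fin n) := ⟨⟨0, hn⟩⟩
  rw [nonempty_compl]
  rintro rfl
  exact NormedSpace.unbounded_univ ℝ (Rn n) hΩb

/-- Uniform seminorm bound for the minimizers cut off outside `Ω`. -/
theorem lintegral_Q_indicator_le {n : ℕ} (Ω : Set (Rn n)) (s : ℝ)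
    {q P : ℝ} (hq : 1 ≤ q) (hqP : q ≤ P) {u : Rn n → ℝ} (hu : AEMeasurable u) {C : ℝ≥0∞}
    (huC : ∫⁻ z in Q Ω, gagliardoIntegrand s q u z.1 z.2 ≤ C)
    (hvC : ∫⁻ z in Q Ω, gagliardoIntegrand s q (Ωᶜ.indicator u) z.1 z.2 ≤ C) :
    ∫⁻ z in Ω ×ˢ univ, gagliardoIntegrand s q (Ω.indicator u) z.1 z.2 ≤
      ENNReal.ofReal (2 ^ (P - 1)) * (C + C) := by
  have e : Ω.indicator u = u + -(Ωᶜ.indicator u) := by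
    rw [eq_add_neg_iff_add_eq, indicator_self_add_compl]
  have hneg : ∫⁻ z in Q Ω, gagliardoIntegrand s q (-(Ωᶜ.indicator u)) z.1 z.2 =
      ∫⁻ z in Q Ω, gagliardoIntegrand s q (Ωᶜ.indicator u) z.1 z.2 := by
    refine lintegral_congr fun z => ?_
    simp only [gagliardoIntegrand, Pi.neg_apply, neg_sub_neg, abs_sub_comm (Ωᶜ.indicator u z.2)]
  refine (lintegral_mono_set (prod_univ_subset_Q Ω)).trans ?_
  rw [e]
  refine (lintegral_Q_add_le s hq hu _).trans ?_
  rw [hneg]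
  gcongr
  exact one_le_two

end FracMin

/-! ### Assembly of the main theorem -/

open FracMin in
theorem theorem1p3 (n : ℕ) (hn : 1 ≤ n) (Ω : Set (FracMin.Rn n))
    (hΩo : IsOpen Ω) (hΩb : Bornology.IsBounded Ω) (hΩL : FracMin.HasLipschitzBoundary Ω)
    (s : ℝ) (hs0 : 0 < s) (hs1 : s < 1)
    (p : ℕ → ℝ) (hp1 : ∀ k, 1 < p k) (hp : Tendsto p atTop (𝓝 1))
    (φk : ℕ → FracMin.Rn n → ℝ) (φ : FracMin.Rn n → ℝ)
    (htail : FracMin.MemL1 Ω (fun x => ⨆ k, FracMin.tail Ω s (p k) (φk k) x))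
    (hφ : ∀ᵐ x ∂(volume.restrict Ωᶜ), Tendsto (fun k => φk k x) atTop (𝓝 (φ x)))
    (u : ℕ → FracMin.Rn n → ℝ)
    (huW : ∀ k, u k ∈ FracMin.spaceWData Ω s (p k) (φk k))
    (humin : ∀ k, FracMin.IsMinimizer Ω s (p k) (u k)) :
    FracMin.MemL1 Ω (FracMin.tail Ω s 1 φ) ∧
    ∃ κ : ℕ → ℕ, StrictMono κ ∧ ∃ u₁ ∈ FracMin.spaceWData Ω s 1 φ,
      Tendsto (fun j => eLpNorm (fun x => u (κ j) x - u₁ x) 1 (volume.restrict Ω)) atTop (𝓝 0) ∧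
      (∀ᵐ x ∂(volume : Measure (FracMin.Rn n)),
        Tendsto (fun j => u (κ j) x) atTop (𝓝 (u₁ x))) ∧
      FracMin.IsMinimizer Ω s 1 u₁ := by
  have hΩm := hΩo.measurableSet
  have hΩfin : volume Ω < ⊤ := hΩb.measure_lt_top
  have hne := nonempty_compl_of_isBounded hn hΩb
  have hum : ∀ k, AEMeasurable (u k) := fun k => (humin k).1.1
  -- Measurability of the exterior data is not assumed; it is inherited from the minimizers, and by
  -- `φ` as an a.e. limit.
  have hφkm : ∀ k, AEMeasurable (φk k) (volume.restrict Ωᶜ) := fun k =>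
    (hum k).restrict.congr (huW k).2
  have hφm : AEMeasurable φ (volume.restrict Ωᶜ) := aemeasurable_of_tendsto_metrizable_ae' hφkm hφ
  refine ⟨⟨aemeasurable_tail s 1 hφm, lt_of_le_of_lt (setLIntegral_mono' hΩm fun x hx =>
    tail_le_iSup_of_tendsto hΩm s hp hφkm hφ hx) htail.2⟩, ?_⟩
  obtain ⟨P, hP⟩ := hp.bddAbove_range
  have hpP : ∀ k, p k ≤ P := fun k => hP (mem_range_self k)
  set T := ∫⁻ x in Ω, ⨆ k, tail Ω s (p k) (φk k) x
  set C := 2 * T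
  have hC : C < ⊤ := ENNReal.mul_lt_top ENNReal.ofNat_lt_top htail.2
  have hvC : ∀ k, ∫⁻ z in Q Ω, gagliardoIntegrand s (p k) (Ωᶜ.indicator (u k)) z.1 z.2 ≤ C := by
    intro k
    refine (lintegral_Q_indicator_compl_le hΩm s (one_pos.trans (hp1 k)) (hum k)
      (huW k).2).trans ?_
    refine mul_le_mul_right (lintegral_mono fun x => ?_) 2
    exact le_iSup (fun k => tail Ω s (p k) (φk k) x) k
  have huC : ∀ k, ∫⁻ z in Q Ω, gagliardoIntegrand s (p k) (u k) z.1 z.2 ≤ C := fun k =>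
    ((humin k).lintegral_Q_le hΩm (one_pos.trans (hp1 k))).trans (hvC k)
  set w : ℕ → Rn n → ℝ := fun k => Ω.indicator (u k)
  have huint : ∀ k, Integrable (u k) (volume.restrict Ω) := by
    intro k
    have : IsFiniteMeasure (volume.restrict Ω) := ⟨by simpa using hΩfin⟩
    exact (humin k).1.2.1.integrable (by
      rw [← ENNReal.ofReal_one]; exact ENNReal.ofReal_le_ofReal (hp1 k).le)
  have hwint : ∀ k, Integrable (w k) := fun k => (integrable_indicator_iff hΩm).2 (huint k)
  obtain ⟨κ₁, hκ₁, w', hw', hlim₁⟩ := exists_subseq_tendsto_L1 hn hs0 hΩm hΩb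
    (fun k => (hp1 k).le) hwint (fun k x hx => indicator_of_notMem hx _)
    (C := ENNReal.ofReal (2 ^ (P - 1)) * (C + C))
    (ENNReal.mul_lt_top ENNReal.ofReal_lt_top (ENNReal.add_lt_top.2 ⟨hC, hC⟩))
    (fun k => lintegral_Q_indicator_le Ω s (hp1 k).le (hpP k) (hum k) (huC k) (hvC k))
  -- `L¹` convergence gives convergence in measure, hence a.e. convergence along a further
  -- subsequence.
  obtain ⟨κ₂, hκ₂, hae⟩ := (tendstoInMeasure_of_tendsto_eLpNorm one_ne_zero
    (fun j => (hwint (κ₁ j)).aestronglyMeasurable) hw'.aestronglyMeasurable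
    hlim₁).exists_seq_tendsto_ae
  set κ : ℕ → ℕ := κ₁ ∘ κ₂
  have hκ : StrictMono κ := hκ₁.comp hκ₂
  -- The `L¹` limit inside is glued to the limit data outside.
  set u₁ : Rn n → ℝ := Ω.indicator w' + Ωᶜ.indicator φ
  have hu₁Ω : ∀ x ∈ Ω, u₁ x = w' x := fun x hx => by simp [u₁, hx]
  have hu₁c : ∀ x ∈ Ωᶜ, u₁ x = φ x := fun x hx => by
    simp [u₁, indicator_of_mem hx, indicator_of_notMem hx]
  have hulim : ∀ᵐ x ∂(volume : Measure (Rn n)),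
      Tendsto (fun j => u (κ j) x) atTop (𝓝 (u₁ x)) := by
    refine ae_of_ae_restrict_of_ae_restrict_compl Ω ?_ ?_
    · filter_upwards [ae_restrict_mem hΩm, ae_restrict_of_ae hae] with x hx h
      rw [hu₁Ω x hx]
      simpa [w, κ, hx] using h
    · filter_upwards [ae_restrict_mem hΩm.compl, hφ, ae_all_iff.2 fun k => (huW k).2]
        with x hx h1 h2
      rw [hu₁c x hx]
      simp_rw [h2]
      exact h1.comp hκ.tendsto_atTop
  have hu₁m : AEMeasurable u₁ := aemeasurable_of_tendsto_metrizable_ae' (fun j => hum (κ j)) hulim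
  have hpκ : Tendsto (fun j => p (κ j)) atTop (𝓝 1) := hp.comp hκ.tendsto_atTop
  have hu₁fin : ∫⁻ z in Q Ω, gagliardoIntegrand s 1 u₁ z.1 z.2 < ⊤ :=
    (lintegral_Q_le_of_tendsto s (fun j => hp1 (κ j)) hpκ (fun j => hum (κ j)) hulim
      fun j => huC (κ j)).trans_lt hC
  have hu₁W : u₁ ∈ spaceW Ω s 1 := by
    refine mem_spaceW_of_lintegral_Q_lt_top one_pos hu₁m ?_ hu₁fin
    rw [ENNReal.ofReal_one, memLp_one_iff_integrable]
    refine hw'.restrict.congr ?_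
    filter_upwards [ae_restrict_mem hΩm] with x hx
    rw [hu₁Ω x hx]
  refine ⟨κ, hκ, u₁, ⟨hu₁W, ?_⟩, ?_, hulim, ?_⟩
  · filter_upwards [ae_restrict_mem hΩm.compl] with x hx using hu₁c x hx
  · refine tendsto_of_tendsto_of_tendsto_of_le_of_le tendsto_const_nhds
      (hlim₁.comp hκ₂.tendsto_atTop) (fun _ => zero_le) fun j => ?_
    refine le_trans (le_of_eq (eLpNorm_congr_ae ?_))
      (eLpNorm_mono_measure _ Measure.restrict_le_self)
    filter_upwards [ae_restrict_mem hΩm] with x hx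
    simp [w, κ, hu₁Ω x hx, hx]
  · refine isMinimizer_one_of_lipschitz hn hs0 hs1 hΩo hΩb hΩL hne hu₁W hu₁fin
      fun ψ M hM hlip hbd hψ0 => ?_
    have hψm : Measurable ψ := by
      have : LipschitzWith M.toNNReal ψ := LipschitzWith.of_dist_le_mul fun x y => by
        rw [Real.dist_eq, dist_eq_norm, Real.coe_toNNReal M (by linarith)]
        exact (hlip x y).trans (by gcongr; exact min_le_right _ _)
      exact this.continuous.measurable
    exact lintegral_Q_le_add_of_tendsto s (fun j => hp1 (κ j)) hpκ (fun j => hum (κ j)) hu₁m hulim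
      hC (fun j => huC (κ j)) hψm.aemeasurable
      (lintegral_Q_lipschitz_lt_top hn hs0 hs1 hΩfin le_rfl hM hlip)
      (tendsto_lintegral_Q_lipschitz hn hs0 hs1 hΩfin (fun j => hp1 (κ j)) (fun j => hpP (κ j))
        hpκ hM hψm hlip)
      fun j => (humin (κ j)).lintegral_Q_le_add_lipschitz hn hs0 hs1 hΩm hΩfin (hp1 (κ j)).le hM
        hψm hlip hbd hψ0
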